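/- Let $\Omega=\{(x,y)\in\mathbb R^2: x^2+y^2<1\}$, $r=\sqrt{x^2+y^2}$, and let $f<0$, $\varphi_{\max}<0$, $\rho\ge 1$ be real constants. Put $\varphi=\varphi_{\max}-\rho+\sqrt{\rho^2-r^2}$ on $\Omega$, $J(v)=\frac12\int_\Omega|\nabla v|^2-\int_\Omega f v$, and $K=\{v\in H^1_0(\Omega): v\ge\varphi \text{ a.e. in }\Omega\}$. By the solution of the obstacle problem we mean the minimizer $u$ of $J$ over $K$, unique up to equality a.e. (i) If $|f|\le 4|\varphi_{\max}|$, then the solution is $u=\frac f4(1-r^2)$ and $J(u)=-\frac{\pi f^2}{16}$. If $|f|<4|\varphi_{\max}|$, then $u>\varphi$ everywhere in $\Omega$; if $|f|=4|\varphi_{\max}|$, then $u=\varphi$ exactly at the origin. (ii) If $|f|>4|\varphi_{\max}|$, then there is exactly one $\psi\in(0,\arcsin\frac1\rho)$ with $$\frac{4(\varphi_{\max}-\rho+\rho\cos\psi)+f\rho^2\sin^2\psi-f}{4\rho\sin\psi\,\ln(\rho\sin\psi)}-\frac{f\rho\sin\psi}{2}=-\tan\psi .$$ With this $\psi$, let $R=\rho\sin\psi\in(0,1)$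 and $A_s=\dfrac{4(\varphi_{\max}-\rho+\rho\cos\psi)+fR^2-f}{4\ln R}$. Then: (a) The solution of the obstacle problem is $u=\varphi$ for $r\le R$ and $u=\frac f4(1-r^2)+A_s\ln r$ for $R<r<1$, and the contact set $\{x\in\Omega: u=\varphi\}$ is exactly $\{r\le R\}$. (b) $u$ is differentiable at every point of $\Omega$, and its gradient, which is also its weak gradient, is $\nabla u=-\frac{(x,y)}{\sqrt{\rho^2-r^2}}$ for $r\le R$ and $\nabla u=\left(\frac{A_s}{r^2}-\frac f2\right)(x,y)$ for $R<r<1$. (c) $J(u)=J_1+J_2$, where $J_1$ and $J_2$ are the contributions to $J(u)$ of $\{r\le R\}$ and $\{R<r<1\}$ respectively, and $$J_1=\frac12\int_{\{r\le R\}}\frac{r^2}{\rho^2-r^2}-\int_{\{r\le R\}}f\left(\varphi_{\max}-\rho+\sqrt{\rho^2-r^2}\right)$$ $$=-\frac{\pi\rho^2}{2}\left[\sin^2\psi+\ln(\cos^2\psi)\right]-\pi f\rho^2(\varphi_{\max}-\rho)\sin^2\psi-\frac{2\pi f\rho^3}{3}\left(1-\sqrt{(1-\sin^2\psi)^3}\right),$$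 $$J_2=\frac12\int_{\{R<r<1\}}\left[\frac{A_s^2}{r^2}-A_sf+\frac{f^2}{4}r^2\right]-\int_{\{R<r<1\}}\left[\frac{f^2}{4}(1-r^2)+A_sf\ln r\right]$$ $$=-\pi A_s^2\ln R+\pi A_s fR^2\ln R-\frac{\pi f^2(1-R^2)}{4}+\frac{3\pi f^2(1-R^4)}{16}.$$ (d) Let $\lambda=\frac{2\rho^2-r^2}{(\rho^2-r^2)^{3/2}}-f$ for $r\le R$ and $\lambda=0$ for $R<r<1$. Up to equality a.e., $\lambda$ is the unique optimal multiplier, that is, the unique $\mu\in L^2(\Omega)$ with $\mu\ge0$ a.e. such that $u$ minimizes $J_\mu(v)=J(v)-\int_\Omega\mu(v-\varphi)$ over $H^1_0(\Omega)$ and $J_\mu(u)=J(u)$. Moreover $\lambda=-(\Delta u+f)$ in the sense of distributions in $\Omega$. -/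

import Mathlib

open scoped ContDiff

noncomputable section

namespace ObstacleProblem

/-- The Euclidean plane. -/
abbrev Plane : Type := EuclideanSpace ℝ (Fin 2)

/-- Lebesgue measure on a subset `Ω` of the plane. -/
abbrev vol (Ω : Set Plane) : MeasureTheory.Measure Plane :=
  (MeasureTheory.volume : MeasureTheory.Measure Plane).restrict Ω

/-- Test functions: smooth functions with compact support inside `Ω`. -/
def IsTestFunction (Ω : Set Plane) (η : Plane → ℝ) : Prop :=
  ContDiff ℝ ∞ η ∧ HasCompactSupport η ∧ tsupport η ⊆ Ω

/-- `g` is a square-integrable weak gradient of `u` on `Ω`: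
`∫_Ω u ∂ᵢη = - ∫_Ω gᵢ η` for all test functions `η` and `i = 1, 2`. -/
def HasWeakGradient (Ω : Set Plane) (u : Plane → ℝ) (g : Plane → Plane) : Prop :=
  MeasureTheory.MemLp g 2 (vol Ω) ∧
    ∀ η : Plane → ℝ, IsTestFunction Ω η → ∀ i : Fin 2,
      ∫ x in Ω, u x * gradient η x i = - ∫ x in Ω, g x i * η x

open Classical in
/-- The weak gradient of `u` on `Ω` (determined almost everywhere when it exists, for open `Ω`
and `u ∈ L²(Ω)`). -/
def weakGrad (Ω : Set Plane) (u : Plane → ℝ) : Plane → Plane :=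
  if h : ∃ g, HasWeakGradient Ω u g then h.choose else 0

/-- The Sobolev space `H¹(Ω)`. -/
def MemH1 (Ω : Set Plane) (u : Plane → ℝ) : Prop :=
  MeasureTheory.MemLp u 2 (vol Ω) ∧ ∃ g, HasWeakGradient Ω u g

/-- The Sobolev space `H¹₀(Ω)`: the closure of the test functions in `H¹(Ω)`. -/
def MemH10 (Ω : Set Plane) (u : Plane → ℝ) : Prop :=
  MemH1 Ω u ∧ ∃ η : ℕ → Plane → ℝ, (∀ n, IsTestFunction Ω (η n)) ∧
    Filter.Tendsto (fun n => MeasureTheory.eLpNorm (fun x => η n x - u x) 2 (vol Ω))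
      Filter.atTop (nhds 0) ∧
    Filter.Tendsto
      (fun n => MeasureTheory.eLpNorm (fun x => gradient (η n) x - weakGrad Ω u x) 2 (vol Ω))
      Filter.atTop (nhds 0)

/-- The contribution of a subset `S ⊆ Ω` to the energy,
`½ ∫_S ∇v·∇v - ∫_S f v`, with the weak gradient taken in `Ω`. -/
def energyOn (Ω S : Set Plane) (f v : Plane → ℝ) : ℝ :=
  (1 / 2) * (∫ x in S, inner ℝ (weakGrad Ω v x) (weakGrad Ω v x)) - ∫ x in S, f x * v x

/-- The energy functional `J(v) = ½ ∫_Ω ∇v·∇v - ∫_Ω f v`. -/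
def energy (Ω : Set Plane) (f v : Plane → ℝ) : ℝ := energyOn Ω Ω f v

/-- The admissible set `K = {v ∈ H¹₀(Ω) : v ≥ φ a.e. in Ω}`. -/
def admissible (Ω : Set Plane) (φ : Plane → ℝ) : Set (Plane → ℝ) :=
  {v | MemH10 Ω v ∧ ∀ᵐ x ∂(vol Ω), φ x ≤ v x}

/-- `u` solves the obstacle problem: it minimizes `J` over `K`. -/
def IsObstacleSolution (Ω : Set Plane) (f φ u : Plane → ℝ) : Prop :=
  u ∈ admissible Ω φ ∧ IsMinOn (energy Ω f) (admissible Ω φ) u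

/-- `u` is the solution of the obstacle problem, unique up to equality a.e. in `Ω`. -/
def IsTheObstacleSolution (Ω : Set Plane) (f φ u : Plane → ℝ) : Prop :=
  IsObstacleSolution Ω f φ u ∧ ∀ v, IsObstacleSolution Ω f φ v → v =ᵐ[vol Ω] u

/-- The cone `Λ` of multipliers: the a.e. nonnegative functions in `L²(Ω)`. -/
def multipliers (Ω : Set Plane) : Set (Plane → ℝ) :=
  {μ | MeasureTheory.MemLp μ 2 (vol Ω) ∧ ∀ᵐ x ∂(vol Ω), 0 ≤ μ x}

/-- The perturbed functional `J_μ(v) = J(v) - ∫_Ω μ (v - φ)`. -/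
def perturbedEnergy (Ω : Set Plane) (f φ μ v : Plane → ℝ) : ℝ :=
  energy Ω f v - ∫ x in Ω, μ x * (v x - φ x)

/-- `μ` is an optimal multiplier for `u`: `μ ∈ Λ`, `u` minimizes `J_μ` over `H¹₀(Ω)`, and
`J_μ(u) = J(u)`. -/
def IsOptimalMultiplier (Ω : Set Plane) (f φ u μ : Plane → ℝ) : Prop :=
  μ ∈ multipliers Ω ∧ MemH10 Ω u ∧ IsMinOn (perturbedEnergy Ω f φ μ) {v | MemH10 Ω v} u ∧
    perturbedEnergy Ω f φ μ u = energy Ω f u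

/-- `h ∈ L²(Ω)` is the distributional Laplacian of `u ∈ H¹(Ω)`. -/
def HasWeakLaplacian (Ω : Set Plane) (u h : Plane → ℝ) : Prop :=
  MemH1 Ω u ∧ MeasureTheory.MemLp h 2 (vol Ω) ∧
    ∀ η : Plane → ℝ, IsTestFunction Ω η →
      - (∫ x in Ω, inner ℝ (weakGrad Ω u x) (gradient η x)) = ∫ x in Ω, h x * η x

/-- The open unit disk. -/
def disk : Set Plane := Metric.ball 0 1

/-- The spherical obstacle `φ_max - ρ + √(ρ² - r²)`. -/
def sphericalObstacle (φmax ρ : ℝ) (x : Plane) : ℝ :=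
  φmax - ρ + Real.sqrt (ρ ^ 2 - ‖x‖ ^ 2)

/-- The solution `f (1 - r²) / 4` of the problem without obstacle. -/
def freeSolution (f : ℝ) (x : Plane) : ℝ := f / 4 * (1 - ‖x‖ ^ 2)

/-- The constant `A_s`, where `R = ρ sin ψ`. -/
def logCoeff (f φmax ρ ψ : ℝ) : ℝ :=
  (4 * (φmax - ρ + ρ * Real.cos ψ) + f * (ρ * Real.sin ψ) ^ 2 - f) /
    (4 * Real.log (ρ * Real.sin ψ))

/-- The nonlinear equation for the angle `ψ`. -/
def ContactEquation (f φmax ρ ψ : ℝ) : Prop :=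
  (4 * (φmax - ρ + ρ * Real.cos ψ) + f * ρ ^ 2 * Real.sin ψ ^ 2 - f) /
      (4 * ρ * Real.sin ψ * Real.log (ρ * Real.sin ψ))
    - f * ρ * Real.sin ψ / 2 = - Real.tan ψ

/-- The solution in the case of contact on the disk of radius `R = ρ sin ψ`. -/
def contactSolution (f φmax ρ ψ : ℝ) (x : Plane) : ℝ :=
  if ρ * Real.sin ψ < ‖x‖ then
    f / 4 * (1 - ‖x‖ ^ 2) + logCoeff f φmax ρ ψ * Real.log ‖x‖
  else sphericalObstacle φmax ρ x

/-- The gradient field of the solution in the case of contact. -/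
def contactGradient (f φmax ρ ψ : ℝ) (x : Plane) : Plane :=
  if ρ * Real.sin ψ < ‖x‖ then (logCoeff f φmax ρ ψ / ‖x‖ ^ 2 - f / 2) • x
  else (- (1 / Real.sqrt (ρ ^ 2 - ‖x‖ ^ 2))) • x

/-- The multiplier `λ` in the case of contact. -/
def contactMultiplier (f ρ ψ : ℝ) (x : Plane) : ℝ :=
  if ρ * Real.sin ψ < ‖x‖ then 0
  else (2 * ρ ^ 2 - ‖x‖ ^ 2) / (ρ ^ 2 - ‖x‖ ^ 2) ^ (3 / 2 : ℝ) - f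

end ObstacleProblem

end

/-! The proof is a verification argument. Suppose `u` lies in `H¹₀`, `-Δu = f + λ` weakly, `λ ≥ 0`,
`u ≥ φ` and `λ (u - φ) = 0`. Expanding the quadratic functional around `u` gives `J(v) = J(u) + ½ ∫
|∇(v - u)|² + ∫ λ (v - u)` for every `v` in `H¹₀` (`IsWeakSolution.energy_eq`). On `K` both extra
terms are nonnegative, so `u` is a minimizer. A second minimizer differs from `u` by a function with
zero gradient, hence by zero. The same expansion, perturbed by test functions, identifies the
optimal multipliers as the functions equal to `λ` a.e.

Both candidates are radial, `u = h(‖x‖²)` with `h` of class `C¹` and `h(1) = 0`. `memH10_radial`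
puts such functions in `H¹₀`. Across the contact circle `h''` jumps, but `h'` has a bounded right
derivative, which is enough for the weak equation (`isWeakSolution_radial`).

If `|f| ≤ 4|φ_max|`, the free solution already lies above the obstacle and `λ = 0`. Otherwise
obstacle and exterior solution are glued at radius `R = ρ sin ψ`: matching values determines `A_s`,
and matching slopes is the contact equation. Cleared of denominators, that equation has a left side
which decreases strictly in `ψ`, is positive at `0` and is negative near `arcsin (1/ρ)`, so it has
exactly one root. The glued function stays strictly above the obstacle outside `R`, because the
derivative of the difference in `s = r²` is positive there. The energies follow from polar
coordinates. -/

namespace ObstacleProblem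

open MeasureTheory Filter Set
open scoped Topology

section

/-! ### Pairings in `L²`, test functions and integration by parts -/

section General

variable {α E : Type*} {m : MeasurableSpace α} {μ : Measure α}
  [NormedAddCommGroup E] [InnerProductSpace ℝ E]

lemma integrable_inner_of_memLp_two {f g : α → E} (hf : MemLp f 2 μ) (hg : MemLp g 2 μ) :
    Integrable (fun x => inner ℝ (f x) (g x)) μ := by
  refine (L2.integrable_inner (𝕜 := ℝ) (hf.toLp f) (hg.toLp g)).congr ?_
  filter_upwards [hf.coeFn_toLp, hg.coeFn_toLp] with x h1 h2
  rw [h1, h2]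

lemma integrable_mul_of_memLp_two {f g : α → ℝ} (hf : MemLp f 2 μ) (hg : MemLp g 2 μ) :
    Integrable (fun x => f x * g x) μ := hf.integrable_mul hg

/-- Continuity of the inner product of `L²`, phrased for representatives. It carries identities from
test functions to their limits in `H¹₀`. -/
lemma tendsto_integral_inner_of_eLpNorm {a w : α → E} {v : ℕ → α → E} (ha : MemLp a 2 μ)
    (hv : ∀ n, MemLp (v n) 2 μ) (hw : MemLp w 2 μ)
    (h : Tendsto (fun n => eLpNorm (fun x => v n x - w x) 2 μ) atTop (𝓝 0)) :
    Tendsto (fun n => ∫ x, inner ℝ (a x) (v n x) ∂μ) atTop (𝓝 (∫ x, inner ℝ (a x) (w x) ∂μ)) := by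
  have key : ∀ {b : α → E} (hb : MemLp b 2 μ),
      ∫ x, inner ℝ (a x) (b x) ∂μ = inner ℝ (ha.toLp a) (hb.toLp b) := by
    intro b hb
    rw [L2.inner_def]
    refine integral_congr_ae ?_
    filter_upwards [ha.coeFn_toLp, hb.coeFn_toLp] with x h1 h2
    rw [h1, h2]
  have h' := (Lp.tendsto_Lp_iff_tendsto_eLpNorm'' v hv w hw).2 h
  simp_rw [key hw, fun n => key (hv n)]
  exact Filter.Tendsto.inner tendsto_const_nhds h'

lemma tendsto_integral_mul_of_eLpNorm {a w : α → ℝ} {v : ℕ → α → ℝ} (ha : MemLp a 2 μ)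
    (hv : ∀ n, MemLp (v n) 2 μ) (hw : MemLp w 2 μ)
    (h : Tendsto (fun n => eLpNorm (fun x => v n x - w x) 2 μ) atTop (𝓝 0)) :
    Tendsto (fun n => ∫ x, a x * v n x ∂μ) atTop (𝓝 (∫ x, a x * w x ∂μ)) := by
  simpa [mul_comm] using tendsto_integral_inner_of_eLpNorm ha hv hw h

end General

lemma gradient_apply (η : Plane → ℝ) (x : Plane) (i : Fin 2) :
    gradient η x i = fderiv ℝ η x (EuclideanSpace.single i 1) := by
  rw [← inner_gradient_left, EuclideanSpace.inner_single_right]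
  simp

lemma continuous_gradient_of_contDiff {η : Plane → ℝ} (h : ContDiff ℝ 1 η) :
    Continuous (gradient η) :=
  (InnerProductSpace.toDual ℝ Plane).symm.continuous.comp (h.continuous_fderiv (by simp))

lemma gradient_fun_add {u v : Plane → ℝ} {x : Plane} (hu : DifferentiableAt ℝ u x)
    (hv : DifferentiableAt ℝ v x) :
    gradient (fun x => u x + v x) x = gradient u x + gradient v x := by
  simp [gradient, fderiv_fun_add hu hv]

lemma gradient_fun_const_mul {u : Plane → ℝ} {x : Plane} (hu : DifferentiableAt ℝ u x) (c : ℝ) :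
    gradient (fun x => c * u x) x = c • gradient u x := by
  simp [gradient, fderiv_const_mul hu c]

variable {Ω : Set Plane}

namespace IsTestFunction

variable {η ζ : Plane → ℝ}

lemma contDiff_one (h : IsTestFunction Ω η) : ContDiff ℝ 1 η := h.1.of_le (by exact_mod_cast le_top)

lemma differentiable (h : IsTestFunction Ω η) : Differentiable ℝ η :=
  h.contDiff_one.differentiable (by simp)

lemma continuous_gradient (h : IsTestFunction Ω η) : Continuous (gradient η) :=
  continuous_gradient_of_contDiff h.contDiff_one

lemma hasCompactSupport_gradient (h : IsTestFunction Ω η) : HasCompactSupport (gradient η) :=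
  (h.2.1.fderiv ℝ).comp_left (g := (InnerProductSpace.toDual ℝ Plane).symm) (map_zero _)

lemma memLp (h : IsTestFunction Ω η) : MemLp η 2 (vol Ω) :=
  (h.1.continuous.memLp_of_hasCompactSupport h.2.1).restrict Ω

lemma memLp_gradient (h : IsTestFunction Ω η) : MemLp (gradient η) 2 (vol Ω) :=
  (h.continuous_gradient.memLp_of_hasCompactSupport h.hasCompactSupport_gradient).restrict Ω

lemma eq_zero_of_notMem (h : IsTestFunction Ω η) {x : Plane} (hx : x ∉ Ω) : η x = 0 :=
  image_eq_zero_of_notMem_tsupport fun hx' => hx (h.2.2 hx')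

lemma gradient_eq_zero_of_notMem (h : IsTestFunction Ω η) {x : Plane} (hx : x ∉ Ω) :
    gradient η x = 0 := by
  have : fderiv ℝ η x = 0 :=
    image_eq_zero_of_notMem_tsupport fun hx' => hx (h.2.2 (tsupport_fderiv_subset ℝ hx'))
  simp [gradient, this]

lemma add (hη : IsTestFunction Ω η) (hζ : IsTestFunction Ω ζ) :
    IsTestFunction Ω (fun x => η x + ζ x) :=
  ⟨hη.1.add hζ.1, hη.2.1.add hζ.2.1,
    (tsupport_add η ζ).trans (union_subset hη.2.2 hζ.2.2)⟩

lemma mul_left (hη : IsTestFunction Ω η) {a : Plane → ℝ} (ha : ContDiff ℝ ∞ a) :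
    IsTestFunction Ω (fun x => a x * η x) :=
  ⟨ha.mul hη.1, hη.2.1.mul_left, (tsupport_mul_subset_right (f := a) (g := η)).trans hη.2.2⟩

lemma const_mul (hη : IsTestFunction Ω η) (c : ℝ) : IsTestFunction Ω (fun x => c * η x) :=
  hη.mul_left contDiff_const

end IsTestFunction

/-- Integration by parts of a `C¹` function against a test function. -/
lemma setIntegral_mul_gradient_apply {u η : Plane → ℝ} (hu : ContDiff ℝ 1 u)
    (hη : IsTestFunction Ω η) (i : Fin 2) :
    ∫ x in Ω, u x * gradient η x i = - ∫ x in Ω, gradient u x i * η x := by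
  -- Both integrands vanish off `Ω`, so the integrals may be taken over the whole plane, where
  -- compact support leaves no boundary term.
  rw [setIntegral_eq_integral_of_forall_compl_eq_zero
      fun x hx => by simp [hη.gradient_eq_zero_of_notMem hx],
    setIntegral_eq_integral_of_forall_compl_eq_zero
      fun x hx => by simp [hη.eq_zero_of_notMem hx]]
  simp_rw [gradient_apply]
  have hu' : Continuous fun x => fderiv ℝ u x (EuclideanSpace.single i 1) :=
    (hu.continuous_fderiv (by simp)).clm_apply continuous_const
  have hη' : Continuous fun x => fderiv ℝ η x (EuclideanSpace.single i 1) :=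
    (hη.contDiff_one.continuous_fderiv (by simp)).clm_apply continuous_const
  have hs : HasCompactSupport fun x => fderiv ℝ η x (EuclideanSpace.single i 1) :=
    (hη.2.1.fderiv ℝ).comp_left (g := fun L : Plane →L[ℝ] ℝ => L (EuclideanSpace.single i 1)) rfl
  refine integral_mul_fderiv_eq_neg_fderiv_mul_of_integrable ?_ ?_ ?_
    (fun x _ => hu.differentiable (by simp) x) (fun x _ => hη.differentiable x)
  · exact (hu'.mul hη.1.continuous).integrable_of_hasCompactSupport hη.2.1.mul_left
  · exact (hu.continuous.mul hη').integrable_of_hasCompactSupport hs.mul_left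
  · exact (hu.continuous.mul hη.1.continuous).integrable_of_hasCompactSupport hη.2.1.mul_left

lemma hasWeakGradient_gradient {u : Plane → ℝ} (hu : ContDiff ℝ 1 u)
    (h : MemLp (gradient u) 2 (vol Ω)) : HasWeakGradient Ω u (gradient u) :=
  ⟨h, fun _ hη i => setIntegral_mul_gradient_apply hu hη i⟩

/-- The fundamental lemma of the calculus of variations, for square-integrable functions. -/
lemma ae_eq_zero_of_forall_test (hΩ : IsOpen Ω) {w : Plane → ℝ} (hw : MemLp w 2 (vol Ω))
    (h : ∀ η, IsTestFunction Ω η → ∫ x in Ω, w x * η x = 0) : w =ᵐ[vol Ω] 0 := by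
  have hw' : LocallyIntegrableOn w Ω volume :=
    locallyIntegrableOn_of_locallyIntegrable_restrict (hw.locallyIntegrable one_le_two)
  have := hΩ.ae_eq_zero_of_integral_contDiff_smul_eq_zero (μ := volume) hw' fun g hg hgc hgs => by
    have hη : IsTestFunction Ω g := ⟨hg, hgc, hgs⟩
    rw [← h g hη, ← setIntegral_eq_integral_of_forall_compl_eq_zero (s := Ω)
      fun x hx => by simp [hη.eq_zero_of_notMem hx]]
    simp_rw [smul_eq_mul, mul_comm]
  exact (ae_restrict_iff' hΩ.measurableSet).2 this

end

/-! ### Weak gradients and the space `H¹₀` -/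

section

variable {Ω : Set Plane} {u v w : Plane → ℝ} {g g₁ g₂ : Plane → Plane}

/-- The fundamental lemma applied to each component. It makes the chosen `weakGrad` agree a.e. with
any explicit weak gradient. -/
lemma HasWeakGradient.ae_eq (hΩ : IsOpen Ω) (h₁ : HasWeakGradient Ω u g₁)
    (h₂ : HasWeakGradient Ω u g₂) : g₁ =ᵐ[vol Ω] g₂ := by
  have key : ∀ i : Fin 2, (fun x => g₁ x i - g₂ x i) =ᵐ[vol Ω] 0 := fun i => by
    have m₁ := h₁.1.eval_piLp i
    have m₂ := h₂.1.eval_piLp i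
    refine ae_eq_zero_of_forall_test hΩ (m₁.sub m₂) fun η hη => ?_
    have e₁ := h₁.2 η hη i
    have e₂ := h₂.2 η hη i
    simp_rw [sub_mul]
    rw [integral_sub (integrable_mul_of_memLp_two m₁ hη.memLp)
      (integrable_mul_of_memLp_two m₂ hη.memLp)]
    linarith
  filter_upwards [key 0, key 1] with x h0 h1
  ext i
  fin_cases i
  · exact sub_eq_zero.1 h0
  · exact sub_eq_zero.1 h1

lemma hasWeakGradient_weakGrad (h : ∃ g, HasWeakGradient Ω u g) :
    HasWeakGradient Ω u (weakGrad Ω u) := by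
  rw [weakGrad, dif_pos h]
  exact h.choose_spec

lemma HasWeakGradient.weakGrad_ae_eq (hΩ : IsOpen Ω) (h : HasWeakGradient Ω u g) :
    weakGrad Ω u =ᵐ[vol Ω] g :=
  (hasWeakGradient_weakGrad ⟨g, h⟩).ae_eq hΩ h

lemma HasWeakGradient.add (hu : MemLp u 2 (vol Ω)) (hv : MemLp v 2 (vol Ω))
    (h₁ : HasWeakGradient Ω u g₁) (h₂ : HasWeakGradient Ω v g₂) :
    HasWeakGradient Ω (fun x => u x + v x) (fun x => g₁ x + g₂ x) := by
  refine ⟨h₁.1.add h₂.1, fun η hη i => ?_⟩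
  have hg := hη.memLp_gradient.eval_piLp i
  simp_rw [PiLp.add_apply, add_mul]
  rw [integral_add (integrable_mul_of_memLp_two hu hg) (integrable_mul_of_memLp_two hv hg),
    integral_add (integrable_mul_of_memLp_two (h₁.1.eval_piLp i) hη.memLp)
      (integrable_mul_of_memLp_two (h₂.1.eval_piLp i) hη.memLp), h₁.2 η hη i, h₂.2 η hη i]
  ring

lemma HasWeakGradient.const_mul (c : ℝ) (h : HasWeakGradient Ω u g) :
    HasWeakGradient Ω (fun x => c * u x) (fun x => c • g x) := by
  refine ⟨h.1.const_smul c, fun η hη i => ?_⟩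
  simp_rw [PiLp.smul_apply, smul_eq_mul, mul_assoc]
  rw [integral_const_mul, integral_const_mul, h.2 η hη i]
  ring

lemma MemH10.memLp (h : MemH10 Ω u) : MemLp u 2 (vol Ω) := h.1.1

lemma MemH10.hasWeakGradient (h : MemH10 Ω u) : HasWeakGradient Ω u (weakGrad Ω u) :=
  hasWeakGradient_weakGrad h.1.2

lemma MemH10.memLp_weakGrad (h : MemH10 Ω u) : MemLp (weakGrad Ω u) 2 (vol Ω) :=
  h.hasWeakGradient.1

/-- Membership in `H¹₀(Ω)` from an explicit weak gradient. -/
lemma MemH10.of_tendsto (hΩ : IsOpen Ω) (hu : MemLp u 2 (vol Ω)) (hg : HasWeakGradient Ω u g)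
    {η : ℕ → Plane → ℝ} (hη : ∀ n, IsTestFunction Ω (η n))
    (h₁ : Tendsto (fun n => eLpNorm (fun x => η n x - u x) 2 (vol Ω)) atTop (𝓝 0))
    (h₂ : Tendsto (fun n => eLpNorm (fun x => gradient (η n) x - g x) 2 (vol Ω)) atTop (𝓝 0)) :
    MemH10 Ω u := by
  refine ⟨⟨hu, g, hg⟩, η, hη, h₁, h₂.congr fun n => eLpNorm_congr_ae ?_⟩
  filter_upwards [hg.weakGrad_ae_eq hΩ] with x hx
  rw [hx]

lemma IsTestFunction.memH10 (hΩ : IsOpen Ω) (h : IsTestFunction Ω u) : MemH10 Ω u :=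
  .of_tendsto hΩ h.memLp (hasWeakGradient_gradient h.contDiff_one h.memLp_gradient)
    (η := fun _ => u) (fun _ => h) (by simp) (by simp)

lemma MemH10.add (hΩ : IsOpen Ω) (hu : MemH10 Ω u) (hv : MemH10 Ω v) :
    MemH10 Ω (fun x => u x + v x) := by
  obtain ⟨η, hη, hη₁, hη₂⟩ := hu.2
  obtain ⟨ζ, hζ, hζ₁, hζ₂⟩ := hv.2
  refine .of_tendsto hΩ (hu.memLp.add hv.memLp)
    (hu.hasWeakGradient.add hu.memLp hv.memLp hv.hasWeakGradient)
    (fun n => (hη n).add (hζ n)) ?_ ?_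
  · refine tendsto_of_tendsto_of_tendsto_of_le_of_le tendsto_const_nhds
      (by simpa using hη₁.add hζ₁) (fun _ => zero_le) fun n => ?_
    refine le_trans (le_of_eq ?_) (eLpNorm_add_le ((hη n).memLp.sub hu.memLp).1
      ((hζ n).memLp.sub hv.memLp).1 one_le_two)
    congr 1
    ext x
    simp only [Pi.add_apply]
    ring
  · refine tendsto_of_tendsto_of_tendsto_of_le_of_le tendsto_const_nhds
      (by simpa using hη₂.add hζ₂) (fun _ => zero_le) fun n => ?_
    refine le_trans (le_of_eq ?_) (eLpNorm_add_le ((hη n).memLp_gradient.sub hu.memLp_weakGrad).1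
      ((hζ n).memLp_gradient.sub hv.memLp_weakGrad).1 one_le_two)
    congr 1
    ext1 x
    rw [gradient_fun_add ((hη n).differentiable x) ((hζ n).differentiable x)]
    simp only [Pi.add_apply]
    abel

lemma MemH10.const_mul (hΩ : IsOpen Ω) (hu : MemH10 Ω u) (c : ℝ) :
    MemH10 Ω (fun x => c * u x) := by
  obtain ⟨η, hη, hη₁, hη₂⟩ := hu.2
  refine .of_tendsto hΩ (hu.memLp.const_mul c) (hu.hasWeakGradient.const_mul c)
    (fun n => (hη n).const_mul c) ?_ ?_
  · have := ENNReal.Tendsto.const_mul (a := ‖c‖ₑ) hη₁ (Or.inr enorm_ne_top)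
    rw [mul_zero] at this
    refine this.congr fun n => ?_
    rw [← eLpNorm_const_smul]
    congr 1
    ext x
    simp [mul_sub]
  · have := ENNReal.Tendsto.const_mul (a := ‖c‖ₑ) hη₂ (Or.inr enorm_ne_top)
    rw [mul_zero] at this
    refine this.congr fun n => ?_
    rw [← eLpNorm_const_smul]
    congr 1
    ext1 x
    rw [gradient_fun_const_mul ((hη n).differentiable x)]
    simp [smul_sub]

lemma MemH10.sub (hΩ : IsOpen Ω) (hu : MemH10 Ω u) (hv : MemH10 Ω v) :
    MemH10 Ω (fun x => u x - v x) := by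
  simpa [sub_eq_add_neg] using hu.add hΩ (hv.const_mul hΩ (-1))

lemma weakGrad_sub_ae_eq (hΩ : IsOpen Ω) (hu : MemH10 Ω u) (hv : MemH10 Ω v) :
    weakGrad Ω (fun x => u x - v x) =ᵐ[vol Ω] fun x => weakGrad Ω u x - weakGrad Ω v x := by
  refine HasWeakGradient.weakGrad_ae_eq hΩ ?_
  simpa [sub_eq_add_neg] using hu.hasWeakGradient.add hu.memLp (hv.memLp.const_mul (-1))
    (hv.hasWeakGradient.const_mul (-1))

/-- An identity tested against test functions extends to `H¹₀(Ω)` by density. -/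
lemma integral_inner_weakGrad_of_forall_test {F : Plane → ℝ} (hg : MemLp g 2 (vol Ω))
    (hF : MemLp F 2 (vol Ω))
    (h : ∀ η, IsTestFunction Ω η →
      ∫ x in Ω, inner ℝ (g x) (gradient η x) = ∫ x in Ω, F x * η x) (hw : MemH10 Ω w) :
    ∫ x in Ω, inner ℝ (g x) (weakGrad Ω w x) = ∫ x in Ω, F x * w x := by
  obtain ⟨η, hη, hη₁, hη₂⟩ := hw.2
  have l₁ := tendsto_integral_inner_of_eLpNorm hg (fun n => (hη n).memLp_gradient)
    hw.memLp_weakGrad hη₂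
  have l₂ := tendsto_integral_mul_of_eLpNorm hF (fun n => (hη n).memLp) hw.memLp hη₁
  exact tendsto_nhds_unique (l₁.congr fun n => h _ (hη n)) l₂

/-- On a bounded open set, a function in `H¹₀(Ω)` with vanishing weak gradient vanishes. -/
lemma MemH10.ae_eq_zero_of_weakGrad (hb : Bornology.IsBounded Ω) (hΩ : MeasurableSet Ω)
    (hw : MemH10 Ω w) (h : weakGrad Ω w =ᵐ[vol Ω] 0) : w =ᵐ[vol Ω] 0 := by
  obtain ⟨η, hη, hη₁, hη₂⟩ := hw.2
  obtain ⟨C, hC⟩ := hb.exists_norm_le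
  have hx0 : ContDiff ℝ ∞ fun x : Plane => x 0 := (EuclideanSpace.proj (𝕜 := ℝ) (0 : Fin 2)).contDiff
  have hxw : MemLp (fun x => x 0 * w x) 2 (vol Ω) := by
    refine hw.memLp.of_le_mul (c := C) (hx0.continuous.aestronglyMeasurable.mul hw.memLp.1) ?_
    filter_upwards [ae_restrict_mem hΩ] with x hx
    rw [norm_mul]
    gcongr
    exact (PiLp.norm_apply_le x 0).trans (hC x hx)
  -- The argument is that of the Poincaré inequality: testing `∇w = 0` against `x₀ ηₙ` and expanding
  -- `∂₀(x₀ ηₙ) = ηₙ + x₀ ∂₀ηₙ` expresses `∫ w ηₙ` through `∂₀ηₙ`. In the limit `∫ w² = -∫ x₀ w ∂₀w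
  -- = 0`.
  have hzero : ∀ n, ∫ x in Ω, w x * η n x = - ∫ x in Ω, (x 0 * w x) * gradient (η n) x 0 := by
    intro n
    have h0 := hw.hasWeakGradient.2 _ ((hη n).mul_left hx0) 0
    have hR : ∫ x in Ω, weakGrad Ω w x 0 * (x 0 * η n x) = 0 := by
      rw [← integral_zero]
      refine integral_congr_ae ?_
      filter_upwards [h] with x hx
      simp [hx]
    rw [hR, neg_zero] at h0
    have hgr : ∀ x, gradient (fun x => x 0 * η n x) x 0 = η n x + x 0 * gradient (η n) x 0 := by
      intro x
      simp_rw [gradient_apply]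
      rw [fderiv_fun_mul (hx0.differentiable (by simp) x) ((hη n).differentiable x)]
      have : fderiv ℝ (fun x : Plane => x 0) x = EuclideanSpace.proj (𝕜 := ℝ) (0 : Fin 2) :=
        (EuclideanSpace.proj (𝕜 := ℝ) (0 : Fin 2)).fderiv
      simp [this]
      ring
    simp_rw [hgr, mul_add] at h0
    have i₁ := integrable_mul_of_memLp_two hw.memLp (hη n).memLp
    have i₂ := integrable_mul_of_memLp_two hxw ((hη n).memLp_gradient.eval_piLp 0)
    have : ∀ x : Plane, w x * (x 0 * gradient (η n) x 0) = x 0 * w x * gradient (η n) x 0 :=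
      fun x => by ring
    simp_rw [this] at h0
    rw [integral_add i₁ i₂] at h0
    linarith
  have l₁ := tendsto_integral_mul_of_eLpNorm hw.memLp (fun n => (hη n).memLp) hw.memLp hη₁
  have l₂ : Tendsto (fun n => ∫ x in Ω, (x 0 * w x) * gradient (η n) x 0) atTop (𝓝 0) := by
    -- The component `∂₀ηₙ` is written as a pairing of `∇ηₙ` with the field `x₀ w e₀`, which is
    -- square-integrable because `Ω` is bounded.
    have := tendsto_integral_inner_of_eLpNorm
      (a := fun x => (x 0 * w x) • (EuclideanSpace.single 0 1 : Plane))
      (by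
        refine MemLp.of_le_mul (c := ‖(EuclideanSpace.single 0 1 : Plane)‖) hxw
          (hxw.1.smul aestronglyMeasurable_const) (Eventually.of_forall fun x => ?_)
        rw [norm_smul, mul_comm])
      (fun n => (hη n).memLp_gradient) hw.memLp_weakGrad hη₂
    have e : ∫ x in Ω, inner ℝ ((x 0 * w x) • (EuclideanSpace.single 0 1 : Plane))
        (weakGrad Ω w x) = 0 := by
      rw [← integral_zero]
      refine integral_congr_ae ?_
      filter_upwards [h] with x hx
      simp [hx]
    rw [e] at this
    refine this.congr fun n => integral_congr_ae (Eventually.of_forall fun x => ?_)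
    simp only [inner_smul_left, EuclideanSpace.inner_single_left]
    simp
  have h0 : ∫ x in Ω, w x * w x = 0 :=
    tendsto_nhds_unique l₁ (by simpa [hzero] using l₂.neg)
  have := (integral_eq_zero_iff_of_nonneg (fun x => mul_self_nonneg (w x))
    (integrable_mul_of_memLp_two hw.memLp hw.memLp)).1 h0
  filter_upwards [this] with x hx
  exact mul_self_eq_zero.1 hx

end

/-! ### Variational theory: energy expansion, minimality, multipliers -/

section

variable {Ω : Set Plane} {f φ u v lam : Plane → ℝ}

/-- The weak form of the equation `-Δu = f + λ`. -/
def IsWeakSolution (Ω : Set Plane) (f lam u : Plane → ℝ) : Prop :=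
  MemH10 Ω u ∧ ∀ η, IsTestFunction Ω η →
    ∫ x in Ω, inner ℝ (weakGrad Ω u x) (gradient η x) = ∫ x in Ω, (lam x + f x) * η x

/-- `J` is quadratic, and its first variation at `u` in the direction `v - u` is `∫ λ (v - u)`: this
is the weak equation, extended by density from test functions to `v - u`. -/
lemma IsWeakSolution.energy_eq (hΩ : IsOpen Ω) (hf : MemLp f 2 (vol Ω)) (hl : MemLp lam 2 (vol Ω))
    (hu : IsWeakSolution Ω f lam u) (hv : MemH10 Ω v) :
    energy Ω f v = energy Ω f u +
      (1 / 2) * (∫ x in Ω, ‖weakGrad Ω (fun x => v x - u x) x‖ ^ 2) +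
      ∫ x in Ω, lam x * (v x - u x) := by
  have hw := hv.sub hΩ hu.1
  have hid := integral_inner_weakGrad_of_forall_test hu.1.memLp_weakGrad (hl.add hf) hu.2 hw
  simp only [Pi.add_apply] at hid
  have hsub := weakGrad_sub_ae_eq hΩ hv hu.1
  have iuu := integrable_inner_of_memLp_two hu.1.memLp_weakGrad hu.1.memLp_weakGrad
  have iuw := integrable_inner_of_memLp_two hu.1.memLp_weakGrad hw.memLp_weakGrad
  have iww := integrable_inner_of_memLp_two hw.memLp_weakGrad hw.memLp_weakGrad
  have e₁ : ∫ x in Ω, inner ℝ (weakGrad Ω v x) (weakGrad Ω v x) =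
      (∫ x in Ω, inner ℝ (weakGrad Ω u x) (weakGrad Ω u x)) +
      2 * (∫ x in Ω, inner ℝ (weakGrad Ω u x) (weakGrad Ω (fun x => v x - u x) x)) +
      ∫ x in Ω, inner ℝ (weakGrad Ω (fun x => v x - u x) x)
        (weakGrad Ω (fun x => v x - u x) x) := by
    have i₂ := iuw.const_mul 2
    have i₃ : Integrable (fun x => inner ℝ (weakGrad Ω u x) (weakGrad Ω u x) +
        2 * inner ℝ (weakGrad Ω u x) (weakGrad Ω (fun x => v x - u x) x)) (vol Ω) := iuu.add i₂
    rw [← integral_const_mul, ← integral_add iuu i₂, ← integral_add i₃ iww]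
    refine integral_congr_ae ?_
    filter_upwards [hsub] with x hx
    have : weakGrad Ω v x = weakGrad Ω u x + weakGrad Ω (fun x => v x - u x) x := by
      rw [hx]; abel
    rw [this, real_inner_add_add_self]
  have jl := integrable_mul_of_memLp_two hl hw.memLp
  have jf := integrable_mul_of_memLp_two hf hw.memLp
  have e₂ : ∫ x in Ω, (lam x + f x) * (v x - u x) =
      (∫ x in Ω, lam x * (v x - u x)) + ∫ x in Ω, f x * (v x - u x) := by
    simp_rw [add_mul]
    exact integral_add jl jf
  have e₃ : ∫ x in Ω, f x * (v x - u x) = (∫ x in Ω, f x * v x) - ∫ x in Ω, f x * u x := by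
    simp_rw [mul_sub]
    exact integral_sub (integrable_mul_of_memLp_two hf hv.memLp)
      (integrable_mul_of_memLp_two hf hu.1.memLp)
  simp_rw [← real_inner_self_eq_norm_sq]
  unfold energy energyOn
  rw [e₁, hid, e₂, e₃]
  ring

/-- Complementarity gives `λ (v - u) = λ (v - φ) ≥ 0` for `v` in `K`, so both extra terms of
`energy_eq` are nonnegative. For another minimizer both vanish, and a difference in `H¹₀` with zero
gradient is zero. -/
lemma IsWeakSolution.isTheObstacleSolution (hΩ : IsOpen Ω) (hb : Bornology.IsBounded Ω)
    (hf : MemLp f 2 (vol Ω)) (hl : lam ∈ multipliers Ω) (hu : IsWeakSolution Ω f lam u)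
    (hφ : ∀ᵐ x ∂(vol Ω), φ x ≤ u x) (hc : ∀ᵐ x ∂(vol Ω), lam x * (u x - φ x) = 0) :
    IsTheObstacleSolution Ω f φ u := by
  have hK : u ∈ admissible Ω φ := ⟨hu.1, hφ⟩
  have hnn : ∀ v ∈ admissible Ω φ, 0 ≤ ∫ x in Ω, lam x * (v x - u x) := by
    refine fun v hv => integral_nonneg_of_ae ?_
    filter_upwards [hv.2, hl.2, hc] with x h1 h2 h3
    have := mul_nonneg h2 (sub_nonneg.2 h1)
    simp only [Pi.zero_apply]
    nlinarith
  have hsq : ∀ v : Plane → ℝ, 0 ≤ ∫ x in Ω, ‖weakGrad Ω (fun x => v x - u x) x‖ ^ 2 :=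
    fun v => integral_nonneg fun x => by positivity
  have hmin : IsMinOn (energy Ω f) (admissible Ω φ) u := by
    refine isMinOn_iff.2 fun v hv => ?_
    rw [hu.energy_eq hΩ hf hl.1 hv.1]
    linarith [hnn v hv, hsq v]
  refine ⟨⟨hK, hmin⟩, fun v hv => ?_⟩
  have h1 := isMinOn_iff.1 hv.2 u hK
  rw [hu.energy_eq hΩ hf hl.1 hv.1.1] at h1
  have h0 : ∫ x in Ω, ‖weakGrad Ω (fun x => v x - u x) x‖ ^ 2 = 0 := by
    linarith [hnn v hv.1, hsq v]
  have hw := hv.1.1.sub hΩ hu.1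
  have h2 := (integral_eq_zero_iff_of_nonneg (fun x => by positivity)
    ((memLp_two_iff_integrable_sq_norm hw.memLp_weakGrad.1).1 hw.memLp_weakGrad)).1 h0
  have h3 := hw.ae_eq_zero_of_weakGrad hb hΩ.measurableSet <| by
    filter_upwards [h2] with x hx
    simpa using hx
  filter_upwards [h3] with x hx
  exact sub_eq_zero.1 hx

/-- Recentring the linear term at `u` separates a constant from the part that depends on `v`, in the
form in which `energy_eq` applies. -/
lemma perturbedEnergy_eq {μ : Plane → ℝ} (hμ : MemLp μ 2 (vol Ω)) (hφ : MemLp φ 2 (vol Ω))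
    (hu : MemLp u 2 (vol Ω)) (hv : MemLp v 2 (vol Ω)) :
    perturbedEnergy Ω f φ μ v = energy Ω f v - (∫ x in Ω, μ x * (v x - u x)) -
      ∫ x in Ω, μ x * (u x - φ x) := by
  have i₁ : Integrable (fun x => μ x * (v x - u x)) (vol Ω) :=
    integrable_mul_of_memLp_two hμ (hv.sub hu)
  have i₂ : Integrable (fun x => μ x * (u x - φ x)) (vol Ω) :=
    integrable_mul_of_memLp_two hμ (hu.sub hφ)
  rw [perturbedEnergy, sub_sub, ← integral_add i₁ i₂]
  congr 2
  ext x
  ring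

/-- Along `u + t η`, `J_μ` changes by `t²E/2 + tD` with `D = ∫ (λ - μ) η`. Minimality forces `D = 0`
for every test function, hence `μ = λ` a.e. For `μ = λ` the linear term disappears and only the
nonnegative square remains. -/
lemma IsWeakSolution.isOptimalMultiplier_iff (hΩ : IsOpen Ω)
    (hf : MemLp f 2 (vol Ω)) (hφ : MemLp φ 2 (vol Ω)) (hl : lam ∈ multipliers Ω)
    (hu : IsWeakSolution Ω f lam u) (hc : ∀ᵐ x ∂(vol Ω), lam x * (u x - φ x) = 0)
    (μ : Plane → ℝ) : IsOptimalMultiplier Ω f φ u μ ↔ μ =ᵐ[vol Ω] lam := by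
  constructor
  · rintro ⟨hμ, -, hmin, -⟩
    have hd : MemLp (fun x => lam x - μ x) 2 (vol Ω) := hl.1.sub hμ.1
    have key : (fun x => lam x - μ x) =ᵐ[vol Ω] 0 := by
      refine ae_eq_zero_of_forall_test hΩ hd fun η hη => ?_
      set D := ∫ x in Ω, (lam x - μ x) * η x with hD
      have hηH := hη.memH10 hΩ
      set E := ∫ x in Ω, ‖weakGrad Ω η x‖ ^ 2 with hE
      have hq : ∀ t : ℝ, 0 ≤ t ^ 2 / 2 * E + t * D := by
        intro t
        have hv : MemH10 Ω fun x => u x + t * η x := hu.1.add hΩ (hηH.const_mul hΩ t)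
        have h1 := isMinOn_iff.1 hmin _ hv
        rw [perturbedEnergy_eq hμ.1 hφ hu.1.memLp hv.memLp,
          perturbedEnergy_eq hμ.1 hφ hu.1.memLp hu.1.memLp, hu.energy_eq hΩ hf hl.1 hv] at h1
        have e₁ : ∫ x in Ω, ‖weakGrad Ω (fun x => u x + t * η x - u x) x‖ ^ 2 = t ^ 2 * E := by
          rw [hE, ← integral_const_mul]
          simp_rw [add_sub_cancel_left]
          refine integral_congr_ae ?_
          filter_upwards [(hηH.hasWeakGradient.const_mul t).weakGrad_ae_eq hΩ] with x hx
          rw [hx, norm_smul, mul_pow, Real.norm_eq_abs, sq_abs]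
        have e₂ : (∫ x in Ω, lam x * (u x + t * η x - u x)) -
            ∫ x in Ω, μ x * (u x + t * η x - u x) = t * D := by
          simp_rw [add_sub_cancel_left]
          rw [← integral_sub (integrable_mul_of_memLp_two hl.1 (hη.memLp.const_mul t))
            (integrable_mul_of_memLp_two hμ.1 (hη.memLp.const_mul t)), hD, ← integral_const_mul]
          congr 1
          ext x
          ring
        rw [e₁] at h1
        simp only [sub_self, mul_zero, integral_zero, sub_zero] at h1
        linarith
      have hE0 : 0 ≤ E := integral_nonneg fun x => by positivity
      -- This `t` makes the quadratic negative unless `D = 0`; `E + 1` in place of `E` avoids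
      -- dividing by zero.
      have := hq (-(D / (E + 1)))
      have hE1 : 0 < E + 1 := by linarith
      have h2 : (-(D / (E + 1))) ^ 2 / 2 * E + -(D / (E + 1)) * D =
          - (D ^ 2 * (E + 2) / (2 * (E + 1) ^ 2)) := by
        field_simp
        ring
      rw [h2] at this
      by_contra hne
      have : 0 < D ^ 2 * (E + 2) / (2 * (E + 1) ^ 2) := by positivity
      linarith
    filter_upwards [key] with x hx
    exact (sub_eq_zero.1 hx).symm
  · intro h
    have hμ : μ ∈ multipliers Ω := ⟨hl.1.ae_eq h.symm, by
      filter_upwards [h, hl.2] with x h1 h2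
      rwa [h1]⟩
    have hμl : ∀ w : Plane → ℝ, ∫ x in Ω, μ x * w x = ∫ x in Ω, lam x * w x := fun w =>
      integral_congr_ae (by filter_upwards [h] with x h1; rw [h1])
    have hz : ∫ x in Ω, lam x * (u x - φ x) = 0 := by
      rw [integral_congr_ae hc, integral_zero]
    refine ⟨hμ, hu.1, isMinOn_iff.2 fun v hv => ?_, ?_⟩
    · rw [perturbedEnergy_eq hμ.1 hφ hu.1.memLp hv.memLp,
        perturbedEnergy_eq hμ.1 hφ hu.1.memLp hu.1.memLp, hu.energy_eq hΩ hf hl.1 hv,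
        hμl fun x => v x - u x]
      have : 0 ≤ ∫ x in Ω, ‖weakGrad Ω (fun x => v x - u x) x‖ ^ 2 :=
        integral_nonneg fun x => by positivity
      simp only [sub_self, mul_zero, integral_zero, sub_zero]
      linarith
    · rw [perturbedEnergy, hμl fun x => u x - φ x, hz, sub_zero]

lemma IsWeakSolution.hasWeakLaplacian (hf : MemLp f 2 (vol Ω)) (hl : MemLp lam 2 (vol Ω))
    (hu : IsWeakSolution Ω f lam u) : HasWeakLaplacian Ω u fun x => -(lam x + f x) := by
  refine ⟨hu.1.1, (hl.add hf).neg, fun η hη => ?_⟩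
  rw [hu.2 η hη, ← integral_neg]
  simp_rw [neg_mul]

end

/-! ### Radial functions on the disk and their membership in `H¹₀` -/

section

/-- Bounded convergence for `L²` norms. Uniform convergence is not to be expected below, since the
approximating slopes vanish at the boundary circle while the limit slope need not. -/
lemma tendsto_eLpNorm_two_of_bounded {α E : Type*} {m : MeasurableSpace α} {μ : Measure α}
    [IsFiniteMeasure μ] [NormedAddCommGroup E] {F : ℕ → α → E} (C : ℝ)
    (hF : ∀ n, AEStronglyMeasurable (F n) μ) (hC : ∀ n, ∀ᵐ x ∂μ, ‖F n x‖ ≤ C)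
    (hlim : ∀ᵐ x ∂μ, Tendsto (fun n => F n x) atTop (𝓝 0)) :
    Tendsto (fun n => eLpNorm (F n) 2 μ) atTop (𝓝 0) := by
  have h : Tendsto (fun n => ∫⁻ x, ‖F n x‖ₑ ^ (2 : ℝ) ∂μ) atTop (𝓝 (∫⁻ _, 0 ∂μ)) := by
    refine tendsto_lintegral_of_dominated_convergence' (fun _ => ENNReal.ofReal C ^ (2 : ℝ))
      (fun n => (hF n).enorm.pow_const _) (fun n => ?_) ?_ ?_
    · filter_upwards [hC n] with x hx
      gcongr
      rw [← ofReal_norm]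
      exact ENNReal.ofReal_le_ofReal hx
    · rw [lintegral_const]
      exact ENNReal.mul_ne_top (ENNReal.rpow_ne_top_of_nonneg (by norm_num) ENNReal.ofReal_ne_top)
        (measure_ne_top _ _)
    · filter_upwards [hlim] with x hx
      have := ((ENNReal.continuous_rpow_const (y := 2)).tendsto _).comp
        ((continuous_enorm.tendsto _).comp hx)
      simpa [Function.comp_def] using this
  have h2 := ((ENNReal.continuous_rpow_const (y := 1 / 2)).tendsto _).comp h
  simp only [lintegral_const, zero_mul] at h2
  rw [ENNReal.zero_rpow_of_pos (by norm_num)] at h2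
  refine h2.congr fun n => ?_
  rw [eLpNorm_eq_lintegral_rpow_enorm_toReal (by norm_num) (by norm_num)]
  simp

lemma isOpen_disk : IsOpen disk := Metric.isOpen_ball

lemma isBounded_disk : Bornology.IsBounded disk := Metric.isBounded_ball

lemma mem_disk_iff {x : Plane} : x ∈ disk ↔ ‖x‖ < 1 := mem_ball_zero_iff

lemma mem_disk_iff_sq {x : Plane} : x ∈ disk ↔ ‖x‖ ^ 2 < 1 := by
  rw [mem_disk_iff, sq_lt_one_iff₀ (norm_nonneg x)]

instance isFiniteMeasure_vol_disk : IsFiniteMeasure (vol disk) :=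
  ⟨by rw [Measure.restrict_apply_univ]; exact measure_ball_lt_top⟩

lemma memLp_disk_of_continuous {E : Type*} [NormedAddCommGroup E] {F : Plane → E}
    (hF : Continuous F) : MemLp F 2 (vol disk) := by
  obtain ⟨C, hC⟩ := (isCompact_closedBall (0 : Plane) 1).exists_bound_of_continuousOn hF.continuousOn
  refine MemLp.of_bound hF.aestronglyMeasurable C ?_
  filter_upwards [ae_restrict_mem isOpen_disk.measurableSet] with x hx
  exact hC x (Metric.ball_subset_closedBall hx)

section Radial

variable {h k : ℝ → ℝ}

/-- The variable `s = ‖x‖²` is used rather than `‖x‖` because it is smooth at the origin. -/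
lemma hasGradientAt_radial {h : ℝ → ℝ} {h' : ℝ} {x : Plane} (hh : HasDerivAt h h' (‖x‖ ^ 2)) :
    HasGradientAt (fun x => h (‖x‖ ^ 2)) ((2 * h') • x) x := by
  rw [hasGradientAt_iff_hasFDerivAt]
  have h1 : HasFDerivAt (fun x : Plane => ‖x‖ ^ 2) (2 • innerSL ℝ x) x :=
    (hasStrictFDerivAt_norm_sq x).hasFDerivAt
  refine (hh.comp_hasFDerivAt x h1).congr_fderiv ?_
  ext y
  simp
  ring

lemma gradient_radial (hh : ∀ s, HasDerivAt h (k s) s) :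
    gradient (fun x : Plane => h (‖x‖ ^ 2)) = fun x => (2 * k (‖x‖ ^ 2)) • x :=
  funext fun _ => (hasGradientAt_radial (hh _)).gradient

lemma contDiff_one_of_hasDerivAt (hh : ∀ s, HasDerivAt h (k s) s) (hk : Continuous k) :
    ContDiff ℝ 1 h := by
  refine contDiff_one_iff_deriv.2 ⟨fun s => (hh s).differentiableAt, ?_⟩
  rwa [show deriv h = k from funext fun s => (hh s).deriv]

lemma contDiff_one_radial (hh : ∀ s, HasDerivAt h (k s) s) (hk : Continuous k) :
    ContDiff ℝ 1 fun x : Plane => h (‖x‖ ^ 2) :=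
  (contDiff_one_of_hasDerivAt hh hk).comp (contDiff_norm_sq ℝ)

lemma hasWeakGradient_radial (hh : ∀ s, HasDerivAt h (k s) s) (hk : Continuous k) :
    HasWeakGradient disk (fun x : Plane => h (‖x‖ ^ 2)) fun x => (2 * k (‖x‖ ^ 2)) • x := by
  have := hasWeakGradient_gradient (Ω := disk) (contDiff_one_radial hh hk)
    (memLp_disk_of_continuous (continuous_gradient_of_contDiff (contDiff_one_radial hh hk)))
  rwa [gradient_radial hh] at this

/-- Smooth functions vanishing near `s ≥ 1` that approximate a continuous function on `[0, 1)`. -/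
lemma exists_smooth_approx (hk : Continuous k) :
    ∃ (q : ℕ → ℝ → ℝ) (δ : ℕ → ℝ) (C : ℝ), (∀ n, ContDiff ℝ ∞ (q n)) ∧ (∀ n, 0 < δ n) ∧
      (∀ n s, 1 - δ n ≤ s → q n s = 0) ∧ (∀ n, ∀ s ∈ Icc (0 : ℝ) 1, |q n s - k s| ≤ C) ∧
      ∀ s ∈ Ico (0 : ℝ) 1, Tendsto (fun n => q n s) atTop (𝓝 (k s)) := by
  obtain ⟨M, hM⟩ := (isCompact_Icc (a := (0 : ℝ)) (b := 1)).exists_bound_of_continuousOn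
    hk.continuousOn
  have hpos : ∀ n : ℕ, 0 < 1 / ((n : ℝ) + 1) := fun n => Nat.one_div_pos_of_nat
  -- Weierstrass polynomials within `1/(n+1)` of `k`. The cutoff multiplying them below is `0` for
  -- `s ≥ 1 - 1/(n+1)` and `1` for `s ≤ 1 - 2/(n+1)`.
  choose p hp using fun n : ℕ =>
    exists_polynomial_near_of_continuousOn 0 1 k hk.continuousOn _ (hpos n)
  refine ⟨fun n s => (p n).eval s * Real.smoothTransition (((n : ℝ) + 1) * (1 - s) - 1),
    fun n => 1 / ((n : ℝ) + 1), 1 + 2 * M, fun n => ?_, hpos, fun n s hs => ?_,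
    fun n s hs => ?_, fun s hs => ?_⟩
  · refine ContDiff.mul ((p n).contDiff_aeval ∞) (Real.smoothTransition.contDiff.comp ?_)
    fun_prop
  · have hn : 0 < (n : ℝ) + 1 := by positivity
    have : 1 - s ≤ 1 / ((n : ℝ) + 1) := by linarith
    rw [le_div_iff₀ hn] at this
    simp only
    rw [Real.smoothTransition.zero_of_nonpos (by linarith), mul_zero]
  · have h1 := hp n s hs
    have h2 := hM s hs
    rw [Real.norm_eq_abs] at h2
    have h3 : 1 / ((n : ℝ) + 1) ≤ 1 := by
      rw [div_le_one (by positivity)]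
      linarith [n.cast_nonneg (α := ℝ)]
    set χ := Real.smoothTransition (((n : ℝ) + 1) * (1 - s) - 1)
    have hχ0 : 0 ≤ χ := Real.smoothTransition.nonneg _
    have hχ1 : χ ≤ 1 := Real.smoothTransition.le_one _
    have e : (p n).eval s * χ - k s = ((p n).eval s - k s) * χ + k s * (χ - 1) := by ring
    rw [e]
    refine (abs_add_le _ _).trans ?_
    rw [abs_mul, abs_mul, abs_of_nonneg hχ0, abs_of_nonpos (by linarith : χ - 1 ≤ 0)]
    nlinarith [abs_nonneg ((p n).eval s - k s), abs_nonneg (k s)]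
  · have hlim : Tendsto (fun n : ℕ => (p n).eval s) atTop (𝓝 (k s)) := by
      rw [tendsto_iff_dist_tendsto_zero]
      refine squeeze_zero (fun _ => dist_nonneg) (fun n => ?_)
        (tendsto_one_div_add_atTop_nhds_zero_nat (𝕜 := ℝ))
      rw [Real.dist_eq]
      exact (hp n s ⟨hs.1, hs.2.le⟩).le
    refine hlim.congr' ?_
    obtain ⟨N, hN⟩ := exists_nat_gt (2 / (1 - s))
    filter_upwards [eventually_ge_atTop N] with n hn
    have h1 : 0 < 1 - s := by linarith [hs.2]
    rw [div_lt_iff₀ h1] at hN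
    have h2 : (N : ℝ) ≤ n := by exact_mod_cast hn
    rw [Real.smoothTransition.one_of_one_le (by nlinarith), mul_one]

/-- A `C¹` radial function vanishing on the unit circle belongs to `H¹₀` of the disk. -/
lemma memH10_radial (hh : ∀ s, HasDerivAt h (k s) s) (hk : Continuous k) (h1 : h 1 = 0) :
    MemH10 disk fun x => h (‖x‖ ^ 2) := by
  obtain ⟨q, δ, C, hq, hδ, hq0, hqC, hql⟩ := exists_smooth_approx hk
  -- Primitives based at `1` inherit the vanishing of `q n` near `1`, so they give test functions.
  -- Since `h 1 = 0`, `h` is itself the primitive of `k` based at `1`, and convergence of slopes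
  -- yields convergence of values.
  set H : ℕ → ℝ → ℝ := fun n s => ∫ t in (1 : ℝ)..s, q n t with hH
  have hHd : ∀ n s, HasDerivAt (H n) (q n s) s := fun n s =>
    intervalIntegral.integral_hasDerivAt_right ((hq n).continuous.intervalIntegrable _ _)
      (hq n).continuous.aestronglyMeasurable.stronglyMeasurableAtFilter (hq n).continuous.continuousAt
  have hHs : ∀ n, ContDiff ℝ ∞ (H n) := fun n => by
    refine contDiff_infty_iff_deriv.2 ⟨fun s => (hHd n s).differentiableAt, ?_⟩
    rw [show deriv (H n) = q n from funext fun s => (hHd n s).deriv]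
    exact hq n
  have hH0 : ∀ n s, 1 - δ n ≤ s → H n s = 0 := fun n s hs => by
    rw [hH, ← intervalIntegral.integral_zero (a := 1) (b := s)]
    refine intervalIntegral.integral_congr fun t ht => hq0 n t ?_
    rcases le_total 1 s with h | h
    · rw [uIcc_of_le h] at ht
      linarith [ht.1, hδ n]
    · rw [uIcc_of_ge h] at ht
      linarith [ht.1]
  have hsub : ∀ n s, H n s - h s = ∫ t in (1 : ℝ)..s, (q n t - k t) := fun n s => by
    rw [intervalIntegral.integral_sub ((hq n).continuous.intervalIntegrable _ _)
      (hk.intervalIntegrable _ _), intervalIntegral.integral_eq_sub_of_hasDerivAt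
      (fun x _ => hh x) (hk.intervalIntegrable _ _), h1, sub_zero]
  have hC0 : 0 ≤ C := (abs_nonneg _).trans (hqC 0 0 (by simp))
  have huI : ∀ s ∈ Ico (0 : ℝ) 1, ∀ t ∈ uIoc 1 s, t ∈ Icc (0 : ℝ) 1 := fun s hs t ht => by
    rw [uIoc_of_ge hs.2.le] at ht
    exact ⟨hs.1.trans ht.1.le, ht.2⟩
  have hmem : ∀ {x : Plane}, x ∈ disk → ‖x‖ ^ 2 ∈ Ico (0 : ℝ) 1 := fun hx =>
    ⟨by positivity, mem_disk_iff_sq.1 hx⟩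
  have htest : ∀ n, IsTestFunction disk fun x => H n (‖x‖ ^ 2) := by
    intro n
    have hsupp : tsupport (fun x : Plane => H n (‖x‖ ^ 2)) ⊆ {x | ‖x‖ ^ 2 ≤ 1 - δ n} := by
      refine closure_minimal (fun x hx => ?_) (isClosed_le (by fun_prop) (by fun_prop))
      by_contra hcon
      exact hx (hH0 n _ (not_le.1 hcon).le)
    have hsub' : {x : Plane | ‖x‖ ^ 2 ≤ 1 - δ n} ⊆ disk := fun x hx =>
      mem_disk_iff_sq.2 (lt_of_le_of_lt hx (by linarith [hδ n]))
    refine ⟨(hHs n).comp (contDiff_norm_sq ℝ), ?_, hsupp.trans hsub'⟩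
    exact HasCompactSupport.of_support_subset_isCompact (isCompact_closedBall (0 : Plane) 1)
      ((subset_tsupport _).trans (hsupp.trans (hsub'.trans Metric.ball_subset_closedBall)))
  have hcont := contDiff_one_radial hh hk
  refine .of_tendsto isOpen_disk (memLp_disk_of_continuous hcont.continuous)
    (hasWeakGradient_radial hh hk) htest ?_ ?_
  · refine tendsto_eLpNorm_two_of_bounded C
      (fun n => ((htest n).1.continuous.sub hcont.continuous).aestronglyMeasurable)
      (fun n => ?_) ?_
    · filter_upwards [ae_restrict_mem isOpen_disk.measurableSet] with x hx
      rw [hsub]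
      refine (intervalIntegral.norm_integral_le_of_norm_le_const (C := C)
        fun t ht => hqC n t (huI _ (hmem hx) t ht)).trans ?_
      have := hmem hx
      rw [abs_of_nonpos (by linarith [this.2])]
      nlinarith [this.1]
    · filter_upwards [ae_restrict_mem isOpen_disk.measurableSet] with x hx
      simp_rw [hsub]
      rw [← intervalIntegral.integral_zero (a := 1) (b := ‖x‖ ^ 2) (E := ℝ) (μ := volume)]
      refine intervalIntegral.tendsto_integral_filter_of_dominated_convergence (fun _ => C)
        (Eventually.of_forall fun n => ((hq n).continuous.sub hk).aestronglyMeasurable)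
        (Eventually.of_forall fun n => Eventually.of_forall fun t ht =>
          hqC n t (huI _ (hmem hx) t ht)) (by simp) ?_
      -- At `t = 1` one has `q n 1 = 0`, so convergence to `k 1` may fail there; one point is
      -- negligible.
      have : ∀ᵐ t : ℝ, t ≠ 1 := by simp [ae_iff]
      filter_upwards [this] with t ht1 ht
      have h2 := huI _ (hmem hx) t ht
      simpa using (hql t ⟨h2.1, lt_of_le_of_ne h2.2 ht1⟩).sub_const (k t)
  · have hgr : ∀ n x, gradient (fun x : Plane => H n (‖x‖ ^ 2)) x - (2 * k (‖x‖ ^ 2)) • x =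
        (2 * (q n (‖x‖ ^ 2) - k (‖x‖ ^ 2))) • x := fun n x => by
      rw [gradient_radial (hHd n), ← sub_smul]
      ring_nf
    simp_rw [hgr]
    refine tendsto_eLpNorm_two_of_bounded (2 * C) (fun n => ?_) (fun n => ?_) ?_
    · have := (hq n).continuous
      exact Continuous.aestronglyMeasurable (by fun_prop)
    · filter_upwards [ae_restrict_mem isOpen_disk.measurableSet] with x hx
      have h2 := hmem hx
      rw [norm_smul, norm_mul, Real.norm_eq_abs, Real.norm_eq_abs, abs_two]
      have h3 := hqC n _ ⟨h2.1, h2.2.le⟩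
      have h4 := (mem_disk_iff.1 hx).le
      have := mul_le_mul h3 h4 (norm_nonneg _) hC0
      linarith
    · filter_upwards [ae_restrict_mem isOpen_disk.measurableSet] with x hx
      have := (((hql _ (hmem hx)).sub_const (k (‖x‖ ^ 2))).const_mul 2).smul_const x
      simpa using this

end Radial

end

/-! ### The weak equation for radial functions -/

section

variable {h k m : ℝ → ℝ}

/-- Integration by parts for the radial field `a(‖x‖²) x` with `a` of class `C¹`. -/
lemma integral_inner_radial_of_contDiff {a a' : ℝ → ℝ} (ha : ∀ s, HasDerivAt a (a' s) s)
    (ha' : Continuous a') {η : Plane → ℝ} (hη : IsTestFunction disk η) :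
    ∫ x in disk, inner ℝ (a (‖x‖ ^ 2) • x) (gradient η x) =
      - ∫ x in disk, (2 * a (‖x‖ ^ 2) + 2 * ‖x‖ ^ 2 * a' (‖x‖ ^ 2)) * η x := by
  have hA := contDiff_one_radial ha ha'
  have hc : ∀ i : Fin 2, ContDiff ℝ 1 fun x : Plane => x i := fun i =>
    (EuclideanSpace.proj (𝕜 := ℝ) i).contDiff
  have hG : ∀ i : Fin 2, ContDiff ℝ 1 fun x : Plane => a (‖x‖ ^ 2) * x i := fun i =>
    hA.mul (hc i)
  -- Summed over the two coordinates, these partial derivatives give the divergence `2a + 2‖x‖² a'`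
  -- in dimension two.
  have hgr : ∀ (i : Fin 2) (x : Plane), gradient (fun x : Plane => a (‖x‖ ^ 2) * x i) x i =
      a (‖x‖ ^ 2) + 2 * a' (‖x‖ ^ 2) * x i ^ 2 := by
    intro i x
    have hA' := gradient_apply (fun x : Plane => a (‖x‖ ^ 2)) x i
    rw [gradient_radial ha] at hA'
    rw [gradient_apply, fderiv_fun_mul (hA.differentiable (by simp) x)
      ((hc i).differentiable (by simp) x)]
    have : fderiv ℝ (fun x : Plane => x i) x = EuclideanSpace.proj (𝕜 := ℝ) i :=
      (EuclideanSpace.proj (𝕜 := ℝ) i).fderiv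
    have hone : EuclideanSpace.proj (𝕜 := ℝ) i (EuclideanSpace.single i (1 : ℝ)) = 1 := by simp
    simp only [this, add_apply, smul_apply, smul_eq_mul, ← hA', PiLp.smul_apply, hone]
    ring
  have hi : ∀ i : Fin 2, Integrable (fun x => a (‖x‖ ^ 2) * x i * gradient η x i) (vol disk) :=
    fun i => integrable_mul_of_memLp_two (memLp_disk_of_continuous (hG i).continuous)
      (hη.memLp_gradient.eval_piLp i)
  have hj : ∀ i : Fin 2, Integrable (fun x => gradient (fun x : Plane => a (‖x‖ ^ 2) * x i) x i *
      η x) (vol disk) := fun i => integrable_mul_of_memLp_two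
    ((memLp_disk_of_continuous (continuous_gradient_of_contDiff (hG i))).eval_piLp i) hη.memLp
  have e₁ : ∀ x : Plane, inner ℝ (a (‖x‖ ^ 2) • x) (gradient η x) =
      a (‖x‖ ^ 2) * x 0 * gradient η x 0 + a (‖x‖ ^ 2) * x 1 * gradient η x 1 := fun x => by
    rw [PiLp.inner_apply, Fin.sum_univ_two]
    simp only [PiLp.smul_apply, smul_eq_mul, RCLike.inner_apply, conj_trivial]
    ring
  have e₂ : ∀ x : Plane, (2 * a (‖x‖ ^ 2) + 2 * ‖x‖ ^ 2 * a' (‖x‖ ^ 2)) * η x =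
      gradient (fun x : Plane => a (‖x‖ ^ 2) * x 0) x 0 * η x +
      gradient (fun x : Plane => a (‖x‖ ^ 2) * x 1) x 1 * η x := fun x => by
    rw [hgr, hgr]
    have : ‖x‖ ^ 2 = x 0 ^ 2 + x 1 ^ 2 := by
      rw [EuclideanSpace.real_norm_sq_eq, Fin.sum_univ_two]
    linear_combination 2 * a' (‖x‖ ^ 2) * η x * this
  simp_rw [e₁, e₂]
  rw [integral_add (hi 0) (hi 1), integral_add (hj 0) (hj 1),
    setIntegral_mul_gradient_apply (hG 0) hη, setIntegral_mul_gradient_apply (hG 1) hη]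
  ring

/-- Integration by parts for the radial field `k(‖x‖²) x` when `k` has a bounded right
derivative `m`. -/
lemma integral_inner_radial_of_rightDeriv (hh : ∀ s, HasDerivAt h (k s) s) (hk : Continuous k)
    (hm : ∀ s ∈ Ico (0 : ℝ) 2, HasDerivWithinAt k (m s) (Ici s) s) {L : ℝ}
    (hL : ∀ s ∈ Ico (0 : ℝ) 2, |m s| ≤ L) {η : Plane → ℝ} (hη : IsTestFunction disk η) :
    ∫ x in disk, inner ℝ (k (‖x‖ ^ 2) • x) (gradient η x) =
      - ∫ x in disk, (2 * k (‖x‖ ^ 2) + 2 * ‖x‖ ^ 2 * m (‖x‖ ^ 2)) * η x := by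
  obtain ⟨M, hM⟩ := (isCompact_Icc (a := (0 : ℝ)) (b := 2)).exists_bound_of_continuousOn
    hk.continuousOn
  set ε : ℕ → ℝ := fun n => 1 / ((n : ℝ) + 1) with hε
  have hε0 : ∀ n, 0 < ε n := fun n => Nat.one_div_pos_of_nat
  have hε1 : ∀ n, ε n ≤ 1 := fun n => by
    rw [hε, div_le_one (by positivity)]
    linarith [n.cast_nonneg (α := ℝ)]
  have hεl : Tendsto ε atTop (𝓝[>] 0) := tendsto_nhdsWithin_iff.2
    ⟨tendsto_one_div_add_atTop_nhds_zero_nat, Eventually.of_forall hε0⟩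
  -- Forward difference quotients of `h` are `C¹`, so the smooth case applies to them. As `ε n ↓ 0`
  -- they tend to `k` and their derivatives to the right derivative `m`. The mean value inequality
  -- bounds both; as `s < 1` and `ε n ≤ 1`, only parameters in `[0, 2)` enter.
  set A : ℕ → ℝ → ℝ := fun n s => (ε n)⁻¹ * (h (s + ε n) - h s) with hA
  set A' : ℕ → ℝ → ℝ := fun n s => (ε n)⁻¹ * (k (s + ε n) - k s) with hA'
  have hAd : ∀ n s, HasDerivAt (A n) (A' n s) s := fun n s =>
    (((hh (s + ε n)).comp_add_const s (ε n)).sub (hh s)).const_mul _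
  have hhc : Continuous h := continuous_iff_continuousAt.2 fun s => (hh s).continuousAt
  have hAc : ∀ n, Continuous (A n) := fun n => by fun_prop
  have hA'c : ∀ n, Continuous (A' n) := fun n => by fun_prop
  have hquot : ∀ {g : ℝ → ℝ} {g' s : ℝ}, HasDerivWithinAt g g' (Ici s) s →
      Tendsto (fun n => (ε n)⁻¹ * (g (s + ε n) - g s)) atTop (𝓝 g') := by
    intro g g' s hg
    have h1 := (hasDerivWithinAt_iff_tendsto_slope' (by simp)).1 (hg.Ioi_of_Ici)
    have h2 : Tendsto (fun n => s + ε n) atTop (𝓝[>] s) := by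
      refine tendsto_nhdsWithin_iff.2 ⟨?_, Eventually.of_forall fun n => by simp [hε0 n]⟩
      simpa using (tendsto_nhds_of_tendsto_nhdsWithin hεl).const_add s
    refine (h1.comp h2).congr fun n => ?_
    simp [slope_def_field, div_eq_inv_mul]
  have hAb : ∀ n, ∀ s ∈ Ico (0 : ℝ) 1, |A n s| ≤ M := fun n s hs => by
    have := norm_image_sub_le_of_norm_deriv_right_le_segment (f := h) (f' := k) (C := M)
      (a := s) (b := s + ε n) hhc.continuousOn (fun x _ => (hh x).hasDerivWithinAt)
      (fun x hx => hM x ⟨by linarith [hx.1, hs.1], by linarith [hx.2, hs.2, hε1 n]⟩) (s + ε n)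
      ⟨by linarith [hε0 n], le_rfl⟩
    rw [hA, abs_mul, abs_of_pos (inv_pos.2 (hε0 n)), inv_mul_le_iff₀ (hε0 n)]
    rw [Real.norm_eq_abs] at this
    linarith
  have hA'b : ∀ n, ∀ s ∈ Ico (0 : ℝ) 1, |A' n s| ≤ L := fun n s hs => by
    have hmem : ∀ x ∈ Ico s (s + ε n), x ∈ Ico (0 : ℝ) 2 := fun x hx =>
      ⟨by linarith [hx.1, hs.1], by linarith [hx.2, hs.2, hε1 n]⟩
    have := norm_image_sub_le_of_norm_deriv_right_le_segment (f := k) (f' := m) (C := L)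
      (a := s) (b := s + ε n) hk.continuousOn (fun x hx => hm x (hmem x hx))
      (fun x hx => hL x (hmem x hx)) (s + ε n) ⟨by linarith [hε0 n], le_rfl⟩
    rw [hA', abs_mul, abs_of_pos (inv_pos.2 (hε0 n)), inv_mul_le_iff₀ (hε0 n)]
    rw [Real.norm_eq_abs] at this
    linarith
  have hmem : ∀ {x : Plane}, x ∈ disk → ‖x‖ ^ 2 ∈ Ico (0 : ℝ) 1 := fun hx =>
    ⟨by positivity, mem_disk_iff_sq.1 hx⟩
  have hη₁ : Integrable η (vol disk) := hη.memLp.integrable one_le_two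
  have hη₂ : Integrable (gradient η) (vol disk) := hη.memLp_gradient.integrable one_le_two
  have l₁ : Tendsto (fun n => ∫ x in disk, inner ℝ (A n (‖x‖ ^ 2) • x) (gradient η x)) atTop
      (𝓝 (∫ x in disk, inner ℝ (k (‖x‖ ^ 2) • x) (gradient η x))) := by
    refine tendsto_integral_of_dominated_convergence (fun x => M * ‖gradient η x‖)
      (fun n => ?_) (hη₂.norm.const_mul M) (fun n => ?_) ?_
    · have := hAc n
      have := hη.continuous_gradient
      exact Continuous.aestronglyMeasurable (by fun_prop)
    · filter_upwards [ae_restrict_mem isOpen_disk.measurableSet] with x hx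
      refine (norm_inner_le_norm _ _).trans ?_
      gcongr
      rw [norm_smul, Real.norm_eq_abs]
      have h1 := hAb n _ (hmem hx)
      have h2 := (mem_disk_iff.1 hx).le
      have := mul_le_mul h1 h2 (norm_nonneg _) ((abs_nonneg _).trans h1)
      linarith
    · filter_upwards [ae_restrict_mem isOpen_disk.measurableSet] with x hx
      exact ((hquot (hh _).hasDerivWithinAt).smul_const x).inner tendsto_const_nhds
  have l₂ : Tendsto (fun n => - ∫ x in disk,
      (2 * A n (‖x‖ ^ 2) + 2 * ‖x‖ ^ 2 * A' n (‖x‖ ^ 2)) * η x) atTop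
      (𝓝 (- ∫ x in disk, (2 * k (‖x‖ ^ 2) + 2 * ‖x‖ ^ 2 * m (‖x‖ ^ 2)) * η x)) := by
    refine Tendsto.neg ?_
    refine tendsto_integral_of_dominated_convergence (fun x => (2 * M + 2 * L) * ‖η x‖)
      (fun n => ?_) (hη₁.norm.const_mul _) (fun n => ?_) ?_
    · have := hAc n
      have := hA'c n
      have := hη.1.continuous
      exact Continuous.aestronglyMeasurable (by fun_prop)
    · filter_upwards [ae_restrict_mem isOpen_disk.measurableSet] with x hx
      rw [norm_mul]
      gcongr
      refine (abs_add_le _ _).trans ?_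
      have h1 := hAb n _ (hmem hx)
      have h2 := hA'b n _ (hmem hx)
      have h3 := hmem hx
      rw [abs_mul 2 (A n (‖x‖ ^ 2)), abs_mul (2 * ‖x‖ ^ 2), abs_two,
        abs_of_nonneg (by linarith [h3.1] : 0 ≤ 2 * ‖x‖ ^ 2)]
      nlinarith [abs_nonneg (A' n (‖x‖ ^ 2)), h3.1, h3.2]
    · filter_upwards [ae_restrict_mem isOpen_disk.measurableSet] with x hx
      have h3 := hmem hx
      have t₁ := hquot (hh (‖x‖ ^ 2)).hasDerivWithinAt
      have t₂ := hquot (hm (‖x‖ ^ 2) ⟨h3.1, by linarith [h3.2]⟩)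
      exact ((t₁.const_mul 2).add (t₂.const_mul _)).mul_const _
  refine tendsto_nhds_unique l₁ (l₂.congr fun n => ?_)
  exact (integral_inner_radial_of_contDiff (hAd n) (hA'c n) hη).symm

/-- A radial function `h(‖x‖²)` solves `-Δu = f + λ` weakly if it does so almost everywhere. -/
lemma isWeakSolution_radial (hh : ∀ s, HasDerivAt h (k s) s) (hk : Continuous k) (h1 : h 1 = 0)
    (hm : ∀ s ∈ Ico (0 : ℝ) 2, HasDerivWithinAt k (m s) (Ici s) s) {L : ℝ}
    (hL : ∀ s ∈ Ico (0 : ℝ) 2, |m s| ≤ L) {f lam : Plane → ℝ}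
    (heq : ∀ᵐ x ∂(vol disk),
      lam x + f x = -(4 * k (‖x‖ ^ 2) + 4 * ‖x‖ ^ 2 * m (‖x‖ ^ 2))) :
    IsWeakSolution disk f lam fun x => h (‖x‖ ^ 2) := by
  refine ⟨memH10_radial hh hk h1, fun η hη => ?_⟩
  have e₁ : ∫ x in disk, inner ℝ (weakGrad disk (fun x => h (‖x‖ ^ 2)) x) (gradient η x) =
      2 * ∫ x in disk, inner ℝ (k (‖x‖ ^ 2) • x) (gradient η x) := by
    rw [← integral_const_mul]
    refine integral_congr_ae ?_
    filter_upwards [(hasWeakGradient_radial hh hk).weakGrad_ae_eq isOpen_disk] with x hx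
    rw [hx, inner_smul_left, inner_smul_left]
    simp
    ring
  rw [e₁, integral_inner_radial_of_rightDeriv hh hk hm hL hη, ← integral_neg, ← integral_const_mul]
  refine integral_congr_ae ?_
  filter_upwards [heq] with x hx
  rw [hx]
  ring

end

/-! ### Gluing at the contact radius -/

section

section Gluing

variable {g₁ g₂ d₁ d₂ : ℝ → ℝ} {a : ℝ}

/-- At `a` the one-sided derivatives exist and agree; this is where value and slope matching are
both needed. -/
lemma hasDerivAt_ite_le (h₁ : ∀ s ≤ a, HasDerivAt g₁ (d₁ s) s)
    (h₂ : ∀ s, a ≤ s → HasDerivAt g₂ (d₂ s) s) (hg : g₁ a = g₂ a) (hd : d₁ a = d₂ a) (s : ℝ) :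
    HasDerivAt (fun s => if s ≤ a then g₁ s else g₂ s) (if s ≤ a then d₁ s else d₂ s) s := by
  rcases lt_trichotomy s a with hs | rfl | hs
  · rw [if_pos hs.le]
    refine (h₁ s hs.le).congr_of_eventuallyEq ?_
    filter_upwards [Iio_mem_nhds hs] with t ht
    rw [if_pos (le_of_lt ht)]
  · rw [if_pos le_rfl]
    have hL : HasDerivWithinAt (fun t => if t ≤ s then g₁ t else g₂ t) (d₁ s) (Iic s) s :=
      (h₁ s le_rfl).hasDerivWithinAt.congr (fun t ht => if_pos ht) (if_pos le_rfl)
    have hR : HasDerivWithinAt (fun t => if t ≤ s then g₁ t else g₂ t) (d₁ s) (Ici s) s := by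
      rw [hd]
      refine (h₂ s le_rfl).hasDerivWithinAt.congr (fun t ht => ?_) (by rw [if_pos le_rfl, hg])
      rcases eq_or_lt_of_le (mem_Ici.1 ht) with rfl | h
      · rw [if_pos le_rfl, hg]
      · rw [if_neg h.not_ge]
    rw [← hasDerivWithinAt_univ, ← Iic_union_Ici (a := s)]
    exact hL.union hR
  · rw [if_neg hs.not_ge]
    refine (h₂ s hs.le).congr_of_eventuallyEq ?_
    filter_upwards [Ioi_mem_nhds hs] with t ht
    rw [if_neg (not_le.2 ht)]

/-- Only values must match: to the right of `a` the function is the second branch. Hence the strict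
test `s < a` in the derivative, which is allowed to jump. -/
lemma hasDerivWithinAt_Ici_ite_le (h₁ : ∀ s < a, HasDerivAt g₁ (d₁ s) s)
    (h₂ : ∀ s, a ≤ s → HasDerivAt g₂ (d₂ s) s) (hg : g₁ a = g₂ a) (s : ℝ) :
    HasDerivWithinAt (fun s => if s ≤ a then g₁ s else g₂ s) (if s < a then d₁ s else d₂ s)
      (Ici s) s := by
  rcases lt_or_ge s a with hs | hs
  · rw [if_pos hs]
    refine ((h₁ s hs).congr_of_eventuallyEq ?_).hasDerivWithinAt
    filter_upwards [Iio_mem_nhds hs] with t ht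
    rw [if_pos (le_of_lt ht)]
  · rw [if_neg hs.not_gt]
    have key : ∀ t, a ≤ t → (if t ≤ a then g₁ t else g₂ t) = g₂ t := fun t ht => by
      rcases eq_or_lt_of_le ht with rfl | h
      · rw [if_pos le_rfl, hg]
      · rw [if_neg h.not_ge]
    exact (h₂ s hs).hasDerivWithinAt.congr (fun t ht => key t (hs.trans ht)) (key s hs)

end Gluing

/-- The matching conditions at the contact radius `R`. -/
structure IsContactData (f φmax ρ R A : ℝ) : Prop where
  f_neg : f < 0
  one_le : 1 ≤ ρ
  pos : 0 < R
  lt_one : R < 1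
  value : f / 4 * (1 - R ^ 2) + A * Real.log R = φmax - ρ + √(ρ ^ 2 - R ^ 2)
  slope : -f / 4 + A / (2 * R ^ 2) = -1 / (2 * √(ρ ^ 2 - R ^ 2))

/-- The contact solution as a function of `s = r²`. -/
noncomputable def contactProfile (f φmax ρ R A s : ℝ) : ℝ :=
  if s ≤ R ^ 2 then φmax - ρ + √(ρ ^ 2 - s) else f / 4 * (1 - s) + A / 2 * Real.log s

/-- The derivative of `contactProfile`. -/
noncomputable def contactSlope (f ρ R A s : ℝ) : ℝ :=
  if s ≤ R ^ 2 then -1 / (2 * √(ρ ^ 2 - s)) else -f / 4 + A / (2 * s)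

/-- The right derivative of `contactSlope`. -/
noncomputable def contactCurvature (ρ R A s : ℝ) : ℝ :=
  if s < R ^ 2 then -1 / (4 * ((ρ ^ 2 - s) * √(ρ ^ 2 - s))) else -A / (2 * s ^ 2)

namespace IsContactData

variable {f φmax ρ R A : ℝ}

lemma sq_lt_one (H : IsContactData f φmax ρ R A) : R ^ 2 < 1 := by
  nlinarith [H.pos, H.lt_one]

lemma one_le_sq (H : IsContactData f φmax ρ R A) : 1 ≤ ρ ^ 2 := by
  nlinarith [H.one_le]

lemma hasDerivAt_sqrt_sub {c s : ℝ} (h : s < c) :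
    HasDerivAt (fun s => √(c - s)) (-1 / (2 * √(c - s))) s :=
  ((hasDerivAt_id' s).const_sub c).sqrt (by linarith)

lemma hasDerivAt_profile (H : IsContactData f φmax ρ R A) (s : ℝ) :
    HasDerivAt (contactProfile f φmax ρ R A) (contactSlope f ρ R A s) s := by
  have h1 := H.sq_lt_one
  have h2 := H.one_le_sq
  have h0 : 0 < R ^ 2 := pow_pos H.pos 2
  refine hasDerivAt_ite_le (g₁ := fun s => φmax - ρ + √(ρ ^ 2 - s))
    (g₂ := fun s => f / 4 * (1 - s) + A / 2 * Real.log s) (d₁ := fun s => -1 / (2 * √(ρ ^ 2 - s)))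
    (d₂ := fun s => -f / 4 + A / (2 * s)) (fun s hs => ?_) (fun s hs => ?_) ?_ H.slope.symm s
  · exact (hasDerivAt_sqrt_sub (by linarith)).const_add _
  · have hs0 : s ≠ 0 := by linarith
    refine ((((hasDerivAt_id' s).const_sub 1).const_mul (f / 4)).add
      ((Real.hasDerivAt_log hs0).const_mul (A / 2))).congr_deriv ?_
    field_simp
  · rw [← H.value, Real.log_pow]
    push_cast
    ring

lemma continuous_slope (H : IsContactData f φmax ρ R A) : Continuous (contactSlope f ρ R A) := by
  have h1 := H.sq_lt_one
  have h2 := H.one_le_sq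
  have h0 : 0 < R ^ 2 := pow_pos H.pos 2
  refine continuous_if_le continuous_id continuous_const ?_ ?_ ?_
  · refine ContinuousOn.div (by fun_prop) (by fun_prop) fun s hs => ?_
    have : 0 < ρ ^ 2 - s := by linarith [show s ≤ R ^ 2 from hs]
    positivity
  · refine ContinuousOn.add (by fun_prop) (ContinuousOn.div (by fun_prop) (by fun_prop) ?_)
    intro s hs
    have : 0 < s := by linarith [show R ^ 2 ≤ s from hs]
    positivity
  · rintro s rfl
    exact H.slope.symm

lemma hasDerivWithinAt_slope (H : IsContactData f φmax ρ R A) (s : ℝ) :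
    HasDerivWithinAt (contactSlope f ρ R A) (contactCurvature ρ R A s) (Ici s) s := by
  have h1 := H.sq_lt_one
  have h2 := H.one_le_sq
  have h0 : 0 < R ^ 2 := pow_pos H.pos 2
  refine hasDerivWithinAt_Ici_ite_le (g₁ := fun s => -1 / (2 * √(ρ ^ 2 - s)))
    (g₂ := fun s => -f / 4 + A / (2 * s))
    (d₁ := fun s => -1 / (4 * ((ρ ^ 2 - s) * √(ρ ^ 2 - s)))) (d₂ := fun s => -A / (2 * s ^ 2)) (fun s hs => ?_) (fun s hs => ?_) H.slope.symm s
  · have hp : 0 < ρ ^ 2 - s := by linarith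
    have hq : 0 < √(ρ ^ 2 - s) := Real.sqrt_pos.2 hp
    have hsq := Real.sq_sqrt hp.le
    refine ((((hasDerivAt_sqrt_sub (c := ρ ^ 2) (by linarith)).const_mul 2).inv
      (by positivity)).neg).congr_deriv ?_ |>.congr_of_eventuallyEq ?_
    · rw [← hsq, Real.sqrt_sq hq.le]
      field_simp
      norm_num
    · filter_upwards with t
      simp [neg_div]
  · have hs0 : s ≠ 0 := by linarith
    refine ((((hasDerivAt_id' s).inv hs0).const_mul (A / 2)).const_add
      (-f / 4)).congr_deriv ?_ |>.congr_of_eventuallyEq ?_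
    · field_simp
    · filter_upwards with t
      simp only [Pi.inv_apply]
      ring

lemma exists_bound_curvature (H : IsContactData f φmax ρ R A) :
    ∃ L, ∀ s ∈ Ico (0 : ℝ) 2, |contactCurvature ρ R A s| ≤ L := by
  have h1 := H.sq_lt_one
  have h2 := H.one_le_sq
  have h0 : 0 < R ^ 2 := pow_pos H.pos 2
  obtain ⟨C₁, hC₁⟩ := (isCompact_Icc (a := (0 : ℝ)) (b := R ^ 2)).exists_bound_of_continuousOn
    (f := fun s => -1 / (4 * ((ρ ^ 2 - s) * √(ρ ^ 2 - s))))
    (ContinuousOn.div (by fun_prop) (by fun_prop) fun s hs => by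
      have : 0 < ρ ^ 2 - s := by linarith [hs.2]
      positivity)
  obtain ⟨C₂, hC₂⟩ := (isCompact_Icc (a := R ^ 2) (b := (2 : ℝ))).exists_bound_of_continuousOn
    (f := fun s => -A / (2 * s ^ 2))
    (ContinuousOn.div (by fun_prop) (by fun_prop) fun s hs => by
      have : 0 < s := by linarith [hs.1]
      positivity)
  refine ⟨max C₁ C₂, fun s hs => ?_⟩
  rw [contactCurvature]
  split_ifs with h
  · exact (hC₁ s ⟨hs.1, h.le⟩).trans (le_max_left _ _)
  · exact (hC₂ s ⟨not_lt.1 h, hs.2.le⟩).trans (le_max_right _ _)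

lemma profile_one (H : IsContactData f φmax ρ R A) : contactProfile f φmax ρ R A 1 = 0 := by
  simp [contactProfile, H.sq_lt_one.not_ge]

/-- Outside the contact radius the solution lies strictly above the obstacle. -/
lemma obstacle_lt (H : IsContactData f φmax ρ R A) {s : ℝ} (hs : R ^ 2 < s) (hs1 : s < 1) :
    φmax - ρ + √(ρ ^ 2 - s) < f / 4 * (1 - s) + A / 2 * Real.log s := by
  have h1 := H.sq_lt_one
  have h2 := H.one_le_sq
  have h0 : 0 < R ^ 2 := pow_pos H.pos 2
  -- Up to a constant this is solution minus obstacle. The value condition fixes it at `R²`, so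
  -- strict monotonicity suffices.
  set w : ℝ → ℝ := fun s => f / 4 * (1 - s) + A / 2 * Real.log s - √(ρ ^ 2 - s) with hw
  have hd : ∀ t ∈ Icc (R ^ 2) s, HasDerivAt w (-f / 4 + A / (2 * t) + 1 / (2 * √(ρ ^ 2 - t))) t := by
    intro t ht
    have ht0 : t ≠ 0 := by linarith [ht.1]
    refine (((((hasDerivAt_id' t).const_sub 1).const_mul (f / 4)).add
      ((Real.hasDerivAt_log ht0).const_mul (A / 2))).sub
      (hasDerivAt_sqrt_sub (c := ρ ^ 2) (by linarith [ht.2]))).congr_deriv ?_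
    have : 0 < √(ρ ^ 2 - t) := Real.sqrt_pos.2 (by linarith [ht.2])
    field_simp
    ring
  have hmono : StrictMonoOn w (Icc (R ^ 2) s) := by
    refine strictMonoOn_of_deriv_pos (convex_Icc _ _)
      (fun t ht => (hd t ht).continuousAt.continuousWithinAt) fun t ht => ?_
    rw [interior_Icc] at ht
    rw [(hd t ⟨ht.1.le, ht.2.le⟩).deriv]
    have ht0 : 0 < t := by linarith [ht.1]
    have q₁ : 0 < √(ρ ^ 2 - t) := Real.sqrt_pos.2 (by linarith [ht.2])
    have q₂ : √(ρ ^ 2 - t) ≤ √(ρ ^ 2 - R ^ 2) := Real.sqrt_le_sqrt (by linarith [ht.1])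
    have q₃ : 1 / (2 * √(ρ ^ 2 - R ^ 2)) ≤ 1 / (2 * √(ρ ^ 2 - t)) := by gcongr
    have q₄ : 0 < 1 / (2 * √(ρ ^ 2 - R ^ 2)) := by
      have := q₁.trans_le q₂
      positivity
    have hslope := H.slope
    set P := 1 / (2 * √(ρ ^ 2 - R ^ 2)) with hP
    rw [neg_div, neg_div, ← hP] at hslope
    -- The slope condition eliminates `A`. With the square-root term bounded below by its value `P`
    -- at `R²`, `t` times the derivative is at least `(t - R²)(P - f/4) > 0`.
    have hA : A = R ^ 2 * (f / 2 - 2 * P) := by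
      have : A / (2 * R ^ 2) = f / 4 - P := by linarith
      rw [div_eq_iff (by positivity)] at this
      linarith
    have : 0 < t * (-f / 4 + A / (2 * t) + P) := by
      have e : t * (-f / 4 + A / (2 * t) + P) = (t - R ^ 2) * (P - f / 4) := by
        rw [hA]
        field_simp
        ring
      rw [e]
      exact mul_pos (by linarith [ht.1]) (by linarith [H.f_neg])
    have := pos_of_mul_pos_right this ht0.le
    linarith
  have := hmono ⟨le_rfl, hs.le⟩ ⟨hs.le, le_rfl⟩ hs
  simp only [hw, Real.log_pow] at this
  have hv := H.value
  push_cast at this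
  linarith

end IsContactData

end

/-! ### Existence and uniqueness of the contact angle -/

section

variable {f φmax ρ ψ : ℝ}

section Angle

lemma sin_pos_of_mem (hψ : ψ ∈ Ioo 0 (Real.arcsin (1 / ρ))) : 0 < Real.sin ψ :=
  Real.sin_pos_of_pos_of_lt_pi hψ.1
    (by linarith [hψ.2, Real.arcsin_le_pi_div_two (1 / ρ), Real.pi_pos])

lemma cos_pos_of_mem (hψ : ψ ∈ Ioo 0 (Real.arcsin (1 / ρ))) : 0 < Real.cos ψ :=
  Real.cos_pos_of_mem_Ioo ⟨by linarith [hψ.1, Real.pi_pos],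
    by linarith [hψ.2, Real.arcsin_le_pi_div_two (1 / ρ)]⟩

lemma radius_pos (hρ : 1 ≤ ρ) (hψ : ψ ∈ Ioo 0 (Real.arcsin (1 / ρ))) : 0 < ρ * Real.sin ψ :=
  mul_pos (by linarith) (sin_pos_of_mem hψ)

lemma radius_lt_one (hρ : 1 ≤ ρ) (hψ : ψ ∈ Ioo 0 (Real.arcsin (1 / ρ))) : ρ * Real.sin ψ < 1 := by
  have h0 : 0 < ρ := by linarith
  have h1 : 1 / ρ ≤ 1 := by rwa [div_le_one h0]
  have h2 : 0 < 1 / ρ := by positivity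
  have h3 := Real.arcsin_le_pi_div_two (1 / ρ)
  have := Real.sin_lt_sin_of_lt_of_le_pi_div_two (x := ψ) (by linarith [hψ.1, Real.pi_pos]) h3 hψ.2
  rw [Real.sin_arcsin (by linarith) h1, lt_div_iff₀ h0] at this
  linarith

lemma log_radius_neg (hρ : 1 ≤ ρ) (hψ : ψ ∈ Ioo 0 (Real.arcsin (1 / ρ))) :
    Real.log (ρ * Real.sin ψ) < 0 :=
  Real.log_neg (radius_pos hρ hψ) (radius_lt_one hρ hψ)

/-- The contact equation, cleared of denominators, reads `contactDefect = 0`. -/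
noncomputable def contactDefect (f φmax ρ ψ : ℝ) : ℝ :=
  φmax - ρ + ρ * Real.cos ψ + f / 4 * (ρ ^ 2 * Real.sin ψ ^ 2 - 1) -
    ρ * Real.sin ψ * Real.log (ρ * Real.sin ψ) *
      (f * ρ * Real.sin ψ / 2 - Real.sin ψ / Real.cos ψ)

lemma contactEquation_iff (hρ : 1 ≤ ρ) (hψ : ψ ∈ Ioo 0 (Real.arcsin (1 / ρ))) :
    ContactEquation f φmax ρ ψ ↔ contactDefect f φmax ρ ψ = 0 := by
  have h1 := (sin_pos_of_mem hψ).ne'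
  have h2 := (log_radius_neg hρ hψ).ne
  have h3 : ρ ≠ 0 := by linarith
  have h4 : 4 * ρ * Real.sin ψ * Real.log (ρ * Real.sin ψ) ≠ 0 := by positivity
  rw [ContactEquation, contactDefect, sub_eq_iff_eq_add, div_eq_iff h4, Real.tan_eq_sin_div_cos]
  constructor <;> intro h <;> linarith

/-- Put `R = ρ sin ψ`. Since `(R log R)' = ρ cos ψ (log R + 1)`, its part without logarithm cancels
exactly the derivative of the first terms. Everything left carries the factor `log R`, so its sign
is visible. -/
lemma hasDerivAt_contactDefect (hρ : 1 ≤ ρ) (hψ : ψ ∈ Ioo 0 (Real.arcsin (1 / ρ))) :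
    HasDerivAt (contactDefect f φmax ρ)
      (-(ρ * Real.log (ρ * Real.sin ψ)) * (f * ρ * Real.sin ψ * Real.cos ψ - Real.sin ψ -
        Real.sin ψ / Real.cos ψ ^ 2)) ψ := by
  have hc := (cos_pos_of_mem hψ).ne'
  have hR := (radius_pos hρ hψ).ne'
  have ds := Real.hasDerivAt_sin ψ
  have dc := Real.hasDerivAt_cos ψ
  have dR := ds.const_mul ρ
  have d₁ := ((dc.const_mul ρ).const_add (φmax - ρ)).add
    ((((ds.pow 2).const_mul (ρ ^ 2)).sub_const 1).const_mul (f / 4))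
  have d₂ := (dR.mul (dR.log hR)).mul (((ds.const_mul (f * ρ)).div_const 2).sub (ds.div dc hc))
  refine (d₁.sub d₂).congr_deriv ?_
  have hsc := Real.sin_sq_add_cos_sq ψ
  have hcc : Real.cos ψ * Real.cos ψ - Real.sin ψ * -Real.sin ψ = 1 := by linarith
  simp only [Pi.mul_apply, Pi.sub_apply, Pi.div_apply, hcc]
  have h3 : ρ ≠ 0 := by linarith
  have h1 := (sin_pos_of_mem hψ).ne'
  field_simp
  ring

lemma strictAntiOn_contactDefect (hf : f < 0) (hρ : 1 ≤ ρ) :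
    StrictAntiOn (contactDefect f φmax ρ) (Ioo 0 (Real.arcsin (1 / ρ))) := by
  refine strictAntiOn_of_deriv_neg (convex_Ioo _ _) (fun ψ hψ =>
    (hasDerivAt_contactDefect hρ hψ).continuousAt.continuousWithinAt) fun ψ hψ => ?_
  rw [interior_Ioo] at hψ
  rw [(hasDerivAt_contactDefect hρ hψ).deriv]
  have hs := sin_pos_of_mem hψ
  have hc := cos_pos_of_mem hψ
  have hl := log_radius_neg hρ hψ
  have h0 : 0 < ρ := by linarith
  refine mul_neg_of_pos_of_neg (by nlinarith) ?_
  have h1 : f * ρ * Real.sin ψ * Real.cos ψ < 0 := by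
    have : 0 < ρ * Real.sin ψ * Real.cos ψ := by positivity
    nlinarith
  have h2 : 0 < Real.sin ψ / Real.cos ψ ^ 2 := by positivity
  linarith

/-- The discarded product has two negative factors, `R log R` and the bracket. Unlike the defect,
the bound is continuous up to `arcsin (1/ρ)` even for `ρ = 1`, where the cosine vanishes. -/
lemma contactDefect_lt (hf : f < 0) (hρ : 1 ≤ ρ) (hψ : ψ ∈ Ioo 0 (Real.arcsin (1 / ρ))) :
    contactDefect f φmax ρ ψ <
      φmax - ρ + ρ * Real.cos ψ + f / 4 * (ρ ^ 2 * Real.sin ψ ^ 2 - 1) := by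
  have hs := sin_pos_of_mem hψ
  have hc := cos_pos_of_mem hψ
  have hR := radius_pos hρ hψ
  have hl := log_radius_neg hρ hψ
  have h1 : 0 < Real.sin ψ / Real.cos ψ := by positivity
  have h2 : f * ρ * Real.sin ψ / 2 < 0 := by nlinarith
  have : 0 < ρ * Real.sin ψ * Real.log (ρ * Real.sin ψ) *
      (f * ρ * Real.sin ψ / 2 - Real.sin ψ / Real.cos ψ) :=
    mul_pos_of_neg_of_neg (mul_neg_of_pos_of_neg hR hl) (by linarith)
  rw [contactDefect]
  linarith

lemma existsUnique_contactAngle (hf : f < 0) (hφ : φmax < 0) (hρ : 1 ≤ ρ)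
    (h : 4 * |φmax| < |f|) :
    ∃! ψ : ℝ, ψ ∈ Ioo 0 (Real.arcsin (1 / ρ)) ∧ ContactEquation f φmax ρ ψ := by
  rw [abs_of_neg hf, abs_of_neg hφ] at h
  have h0 : 0 < ρ := by linarith
  have hι : 0 < Real.arcsin (1 / ρ) := Real.arcsin_pos.2 (by positivity)
  -- At the endpoint `ρ sin ψ = 1`, so the bound becomes `φ_max - ρ (1 - cos ψ) ≤ φ_max < 0`.
  -- Continuity then provides a negative value at some `b` strictly inside the interval.
  have hlow : ∀ᶠ ψ in 𝓝[<] Real.arcsin (1 / ρ),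
      φmax - ρ + ρ * Real.cos ψ + f / 4 * (ρ ^ 2 * Real.sin ψ ^ 2 - 1) < 0 := by
    have hc : Continuous fun ψ : ℝ =>
      φmax - ρ + ρ * Real.cos ψ + f / 4 * (ρ ^ 2 * Real.sin ψ ^ 2 - 1) := by fun_prop
    refine nhdsWithin_le_nhds (hc.continuousAt.eventually_lt continuousAt_const ?_)
    have h1 : 1 / ρ ≤ 1 := by rwa [div_le_one h0]
    have h2 : 0 < 1 / ρ := by positivity
    rw [Real.sin_arcsin (by linarith) h1]
    have : ρ ^ 2 * (1 / ρ) ^ 2 - 1 = 0 := by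
      field_simp
      norm_num
    rw [this]
    nlinarith [Real.cos_le_one (Real.arcsin (1 / ρ))]
  obtain ⟨b, hb, hbm⟩ := (hlow.and (Ioo_mem_nhdsLT hι)).exists
  have hcont : ContinuousOn (contactDefect f φmax ρ) (Icc 0 b) := by
    -- `t log t` is continuous at `0` with value `0`, so the interval may be closed at `ψ = 0`.
    have hlog : Continuous fun ψ => ρ * Real.sin ψ * Real.log (ρ * Real.sin ψ) :=
      Real.continuous_mul_log.comp (by fun_prop : Continuous fun ψ => ρ * Real.sin ψ)
    unfold contactDefect
    refine ContinuousOn.sub (by fun_prop) (hlog.continuousOn.mul (ContinuousOn.sub (by fun_prop)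
      (ContinuousOn.div (by fun_prop) (by fun_prop) fun ψ hψ => ?_)))
    exact (Real.cos_pos_of_mem_Ioo ⟨by linarith [hψ.1, Real.pi_pos],
      by linarith [hψ.2, hbm.2, Real.arcsin_le_pi_div_two (1 / ρ)]⟩).ne'
  -- This is positive exactly when `|f| > 4|φ_max|`.
  have hzero : contactDefect f φmax ρ 0 = φmax - f / 4 := by
    simp [contactDefect]
    ring
  obtain ⟨ψ, hψ, hψ0⟩ := intermediate_value_Ioo' hbm.1.le hcont
    (show (0 : ℝ) ∈ Ioo (contactDefect f φmax ρ b) (contactDefect f φmax ρ 0) from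
      ⟨(contactDefect_lt hf hρ hbm).trans hb, by rw [hzero]; linarith⟩)
  have hψm : ψ ∈ Ioo 0 (Real.arcsin (1 / ρ)) := ⟨hψ.1, hψ.2.trans hbm.2⟩
  refine ⟨ψ, ⟨hψm, (contactEquation_iff hρ hψm).2 hψ0⟩, fun χ hχ => ?_⟩
  refine (strictAntiOn_contactDefect (φmax := φmax) hf hρ).injOn hχ.1 hψm ?_
  rw [(contactEquation_iff hρ hχ.1).1 hχ.2, hψ0]

lemma sqrt_sub_radius_sq (hρ : 1 ≤ ρ) (hψ : ψ ∈ Ioo 0 (Real.arcsin (1 / ρ))) :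
    √(ρ ^ 2 - (ρ * Real.sin ψ) ^ 2) = ρ * Real.cos ψ := by
  have h : ρ ^ 2 - (ρ * Real.sin ψ) ^ 2 = (ρ * Real.cos ψ) ^ 2 := by
    linear_combination -ρ ^ 2 * Real.sin_sq_add_cos_sq ψ
  rw [h, Real.sqrt_sq (mul_nonneg (by linarith) (cos_pos_of_mem hψ).le)]

/-- `logCoeff` is the solution of the value condition for `A`. The contact equation says `A = R (f R
/ 2 - tan ψ)`, which is the slope condition because `√(ρ² - R²) = ρ cos ψ`. -/
lemma isContactData_of_contactEquation (hf : f < 0) (hρ : 1 ≤ ρ)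
    (hψ : ψ ∈ Ioo 0 (Real.arcsin (1 / ρ))) (h : ContactEquation f φmax ρ ψ) :
    IsContactData f φmax ρ (ρ * Real.sin ψ) (logCoeff f φmax ρ ψ) := by
  have hs := (sin_pos_of_mem hψ).ne'
  have hc := (cos_pos_of_mem hψ).ne'
  have hl := (log_radius_neg hρ hψ).ne
  have h0 : ρ ≠ 0 := by linarith
  refine ⟨hf, hρ, radius_pos hρ hψ, radius_lt_one hρ hψ, ?_, ?_⟩
  · rw [sqrt_sub_radius_sq hρ hψ, logCoeff]
    field_simp
    ring
  · have h1 : logCoeff f φmax ρ ψ = ρ * Real.sin ψ *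
        (f * ρ * Real.sin ψ / 2 - Real.sin ψ / Real.cos ψ) := by
      rw [contactEquation_iff hρ hψ, contactDefect] at h
      rw [logCoeff, div_eq_iff (mul_ne_zero four_ne_zero hl)]
      linarith
    rw [sqrt_sub_radius_sq hρ hψ, h1]
    field_simp
    ring

end Angle

lemma contactSolution_eq (hR : 0 < ρ * Real.sin ψ) :
    contactSolution f φmax ρ ψ = fun x =>
      contactProfile f φmax ρ (ρ * Real.sin ψ) (logCoeff f φmax ρ ψ) (‖x‖ ^ 2) := by
  ext x
  have hiff : ρ * Real.sin ψ < ‖x‖ ↔ ¬ ‖x‖ ^ 2 ≤ (ρ * Real.sin ψ) ^ 2 := by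
    rw [not_le, sq_lt_sq₀ hR.le (norm_nonneg x)]
  by_cases h : ‖x‖ ^ 2 ≤ (ρ * Real.sin ψ) ^ 2
  · rw [contactSolution, contactProfile, if_pos h, if_neg (by simpa [hiff] using h),
      sphericalObstacle]
  · rw [contactSolution, contactProfile, if_neg h, if_pos (hiff.2 h), Real.log_pow]
    push_cast
    ring

lemma contactGradient_eq (hR : 0 < ρ * Real.sin ψ) :
    contactGradient f φmax ρ ψ = fun x =>
      (2 * contactSlope f ρ (ρ * Real.sin ψ) (logCoeff f φmax ρ ψ) (‖x‖ ^ 2)) • x := by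
  ext1 x
  have hiff : ρ * Real.sin ψ < ‖x‖ ↔ ¬ ‖x‖ ^ 2 ≤ (ρ * Real.sin ψ) ^ 2 := by
    rw [not_le, sq_lt_sq₀ hR.le (norm_nonneg x)]
  by_cases h : ‖x‖ ^ 2 ≤ (ρ * Real.sin ψ) ^ 2
  · rw [contactGradient, contactSlope, if_pos h, if_neg (by simpa [hiff] using h)]
    congr 1
    ring
  · rw [contactGradient, contactSlope, if_neg h, if_pos (hiff.2 h)]
    congr 1
    have : ‖x‖ ≠ 0 := (hR.trans (hiff.2 h)).ne'
    field_simp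
    ring

/-- For `u = h(‖x‖²)` in the plane, `Δu = 4h' + 4‖x‖² h''`. On the circle itself the multiplier
takes its contact value but the curvature its exterior value, hence the exclusion. -/
lemma contactMultiplier_add_eq (hρ : 1 ≤ ρ) (hR : 0 < ρ * Real.sin ψ) (hR1 : ρ * Real.sin ψ < 1)
    {x : Plane} (hx : ‖x‖ ≠ ρ * Real.sin ψ) (A : ℝ) :
    contactMultiplier f ρ ψ x + f = -(4 * contactSlope f ρ (ρ * Real.sin ψ) A (‖x‖ ^ 2) +
      4 * ‖x‖ ^ 2 * contactCurvature ρ (ρ * Real.sin ψ) A (‖x‖ ^ 2)) := by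
  rcases lt_or_gt_of_ne hx with h | h
  · have h2 : ‖x‖ ^ 2 < (ρ * Real.sin ψ) ^ 2 := (sq_lt_sq₀ (norm_nonneg x) hR.le).2 h
    rw [contactMultiplier, contactSlope, contactCurvature, if_pos h2, if_pos h2.le,
      if_neg h.not_gt]
    have hp : 0 < ρ ^ 2 - ‖x‖ ^ 2 := by nlinarith
    have hq : 0 < √(ρ ^ 2 - ‖x‖ ^ 2) := Real.sqrt_pos.2 hp
    have hpow : (ρ ^ 2 - ‖x‖ ^ 2) ^ (3 / 2 : ℝ) = (ρ ^ 2 - ‖x‖ ^ 2) * √(ρ ^ 2 - ‖x‖ ^ 2) := by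
      rw [Real.sqrt_eq_rpow, ← Real.rpow_one_add' hp.le (by norm_num)]
      norm_num
    rw [hpow]
    field_simp
    ring
  · have h2 : (ρ * Real.sin ψ) ^ 2 < ‖x‖ ^ 2 := (sq_lt_sq₀ hR.le (norm_nonneg x)).2 h
    rw [contactMultiplier, contactSlope, contactCurvature, if_neg h2.not_ge, if_neg h2.not_gt,
      if_pos h]
    have : ‖x‖ ≠ 0 := (hR.trans h).ne'
    field_simp
    ring

end

/-! ### Energy integrals in polar coordinates -/

section

section RadialIntegrals

/-- Integration of a radial function in polar coordinates. -/
lemma setIntegral_radial {T : Set ℝ} (hT : MeasurableSet T) (F : ℝ → ℝ) :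
    ∫ x in {x : Plane | ‖x‖ ∈ T}, F ‖x‖ = 2 * Real.pi * ∫ r in Ioi 0 ∩ T, r * F r := by
  have hm : MeasurableSet {x : Plane | ‖x‖ ∈ T} := measurable_norm hT
  rw [← integral_indicator hm]
  have e : ({x : Plane | ‖x‖ ∈ T}.indicator fun x => F ‖x‖) = fun x => T.indicator F ‖x‖ := by
    ext x
    by_cases h : ‖x‖ ∈ T
    · rw [indicator_of_mem h, indicator_of_mem (show x ∈ {x : Plane | ‖x‖ ∈ T} from h)]
    · rw [indicator_of_notMem h, indicator_of_notMem (show x ∉ {x : Plane | ‖x‖ ∈ T} from h)]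
  rw [e, integral_fun_norm_addHaar, finrank_euclideanSpace_fin, Measure.real,
    EuclideanSpace.volume_ball_fin_two, ← setIntegral_indicator hT]
  simp only [ENNReal.ofReal_one, one_pow, one_mul, ENNReal.toReal_ofReal Real.pi_pos.le,
    smul_eq_mul, nsmul_eq_mul]
  push_cast
  rw [mul_assoc]
  congr 2
  refine integral_congr_ae (Eventually.of_forall fun r => ?_)
  by_cases h : r ∈ T <;> simp [h]

lemma setIntegral_radial_closedBall {R : ℝ} (hR : 0 ≤ R) (F : ℝ → ℝ) :
    ∫ x in {x : Plane | ‖x‖ ≤ R}, F ‖x‖ = 2 * Real.pi * ∫ r in (0 : ℝ)..R, r * F r := by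
  have := setIntegral_radial (measurableSet_Iic (a := R)) F
  rwa [Ioi_inter_Iic, ← intervalIntegral.integral_of_le hR] at this

lemma setIntegral_radial_annulus {R : ℝ} (hR : 0 ≤ R) (hR1 : R ≤ 1) (F : ℝ → ℝ) :
    ∫ x in disk \ {x : Plane | ‖x‖ ≤ R}, F ‖x‖ = 2 * Real.pi * ∫ r in R..1, r * F r := by
  have hs : disk \ {x : Plane | ‖x‖ ≤ R} = {x : Plane | ‖x‖ ∈ Ioo R 1} := by
    ext x
    simp only [Set.mem_sdiff, mem_disk_iff]
    constructor
    · exact fun h => ⟨not_le.1 h.2, h.1⟩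
    · exact fun h => ⟨h.2, not_le.2 h.1⟩
  rw [hs, setIntegral_radial measurableSet_Ioo, intervalIntegral.integral_of_le hR1,
    integral_Ioc_eq_integral_Ioo]
  congr 3
  exact inter_eq_right.2 fun r hr => hR.trans_lt hr.1

lemma setIntegral_radial_disk (F : ℝ → ℝ) :
    ∫ x in disk, F ‖x‖ = 2 * Real.pi * ∫ r in (0 : ℝ)..1, r * F r := by
  have hs : disk = {x : Plane | ‖x‖ ∈ Iio 1} := by
    ext x
    exact mem_disk_iff
  rw [hs, setIntegral_radial measurableSet_Iio, intervalIntegral.integral_of_le zero_le_one,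
    integral_Ioc_eq_integral_Ioo, Ioi_inter_Iio]

lemma integral_contact_gradient {ρ R : ℝ} (hR : 0 ≤ R) (hRρ : R < ρ) :
    ∫ x in {x : Plane | ‖x‖ ≤ R}, ‖x‖ ^ 2 / (ρ ^ 2 - ‖x‖ ^ 2) =
      -Real.pi * (R ^ 2 + ρ ^ 2 * (Real.log (ρ ^ 2 - R ^ 2) - Real.log (ρ ^ 2))) := by
  rw [setIntegral_radial_closedBall hR fun r => r ^ 2 / (ρ ^ 2 - r ^ 2)]
  have hp : ∀ r ∈ uIcc 0 R, ρ ^ 2 - r ^ 2 ≠ 0 := fun r hr => by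
    rw [uIcc_of_le hR] at hr
    nlinarith [hr.1, hr.2]
  -- The antiderivative comes from `r³/(ρ² - r²) = -r + ρ² r/(ρ² - r²)`.
  rw [intervalIntegral.integral_eq_sub_of_hasDerivAt
    (f := fun r => -r ^ 2 / 2 - ρ ^ 2 / 2 * Real.log (ρ ^ 2 - r ^ 2)) (fun r hr => ?_)
    (ContinuousOn.intervalIntegrable ?_)]
  · simp only [sub_zero, ne_eq, OfNat.ofNat_ne_zero, not_false_eq_true, zero_pow]
    ring
  · exact continuousOn_id.mul (ContinuousOn.div (by fun_prop) (by fun_prop) hp)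
  · have h0 := hp r hr
    refine (((hasDerivAt_pow 2 r).neg.div_const 2).sub
      ((((hasDerivAt_pow 2 r).const_sub (ρ ^ 2)).log h0).const_mul (ρ ^ 2 / 2))).congr_deriv ?_
    field_simp
    ring

lemma integral_contact_obstacle {φmax ρ R : ℝ} (f : ℝ) (hR : 0 ≤ R) (hRρ : R < ρ) :
    ∫ x in {x : Plane | ‖x‖ ≤ R}, f * (φmax - ρ + √(ρ ^ 2 - ‖x‖ ^ 2)) =
      Real.pi * f * (φmax - ρ) * R ^ 2 +
        2 * Real.pi * f / 3 * (ρ ^ 3 - √(ρ ^ 2 - R ^ 2) ^ 3) := by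
  rw [setIntegral_radial_closedBall hR fun r => f * (φmax - ρ + √(ρ ^ 2 - r ^ 2))]
  have hp : ∀ r ∈ uIcc 0 R, 0 < ρ ^ 2 - r ^ 2 := fun r hr => by
    rw [uIcc_of_le hR] at hr
    nlinarith [hr.1, hr.2]
  rw [intervalIntegral.integral_eq_sub_of_hasDerivAt
    (f := fun r => f * ((φmax - ρ) * r ^ 2 / 2 - √(ρ ^ 2 - r ^ 2) ^ 3 / 3)) (fun r hr => ?_)
    (Continuous.intervalIntegrable (by fun_prop) _ _)]
  · simp only [sub_zero, ne_eq, OfNat.ofNat_ne_zero, not_false_eq_true, zero_pow,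
      Real.sqrt_sq (hR.trans hRρ.le)]
    ring
  · have h0 := hp r hr
    have hq : 0 < √(ρ ^ 2 - r ^ 2) := Real.sqrt_pos.2 h0
    refine (((((hasDerivAt_pow 2 r).const_mul (φmax - ρ)).div_const 2).sub
      (((((hasDerivAt_pow 2 r).const_sub (ρ ^ 2)).sqrt h0.ne').pow 3).div_const 3)).const_mul
        f).congr_deriv ?_
    field_simp
    ring

lemma integral_free_gradient {R : ℝ} (f A : ℝ) (hR : 0 < R) (hR1 : R ≤ 1) :
    ∫ x in disk \ {x : Plane | ‖x‖ ≤ R}, (A ^ 2 / ‖x‖ ^ 2 - A * f + f ^ 2 / 4 * ‖x‖ ^ 2) =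
      2 * Real.pi * (-(A ^ 2 * Real.log R) - A * f * (1 - R ^ 2) / 2 +
        f ^ 2 * (1 - R ^ 4) / 16) := by
  rw [setIntegral_radial_annulus hR.le hR1 fun r => A ^ 2 / r ^ 2 - A * f + f ^ 2 / 4 * r ^ 2]
  have hp : ∀ r ∈ uIcc R 1, r ≠ 0 := fun r hr => by
    rw [uIcc_of_le hR1] at hr
    linarith [hr.1]
  rw [intervalIntegral.integral_eq_sub_of_hasDerivAt
    (f := fun r => A ^ 2 * Real.log r - A * f * r ^ 2 / 2 + f ^ 2 * r ^ 4 / 16) (fun r hr => ?_)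
    (ContinuousOn.intervalIntegrable ?_)]
  · simp only [Real.log_one]
    ring
  · refine continuousOn_id.mul (ContinuousOn.add (ContinuousOn.sub (ContinuousOn.div (by fun_prop)
      (by fun_prop) fun r hr => pow_ne_zero 2 (hp r hr)) (by fun_prop)) (by fun_prop))
  · have h0 := hp r hr
    refine ((((Real.hasDerivAt_log h0).const_mul (A ^ 2)).sub
      (((hasDerivAt_pow 2 r).const_mul (A * f)).div_const 2)).add
      (((hasDerivAt_pow 4 r).const_mul (f ^ 2)).div_const 16)).congr_deriv ?_
    field_simp
    ring

lemma integral_free_load {R : ℝ} (f A : ℝ) (hR : 0 < R) (hR1 : R ≤ 1) :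
    ∫ x in disk \ {x : Plane | ‖x‖ ≤ R},
        (f ^ 2 / 4 * (1 - ‖x‖ ^ 2) + A * f * Real.log ‖x‖) =
      2 * Real.pi * (f ^ 2 / 4 * ((1 - R ^ 2) / 2 - (1 - R ^ 4) / 4) +
        A * f * (-1 / 4 - R ^ 2 / 2 * Real.log R + R ^ 2 / 4)) := by
  rw [setIntegral_radial_annulus hR.le hR1
    fun r => f ^ 2 / 4 * (1 - r ^ 2) + A * f * Real.log r]
  have hp : ∀ r ∈ uIcc R 1, r ≠ 0 := fun r hr => by
    rw [uIcc_of_le hR1] at hr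
    linarith [hr.1]
  rw [intervalIntegral.integral_eq_sub_of_hasDerivAt
    (f := fun r => f ^ 2 / 4 * (r ^ 2 / 2 - r ^ 4 / 4) +
      A * f * (r ^ 2 / 2 * Real.log r - r ^ 2 / 4)) (fun r hr => ?_)
    (ContinuousOn.intervalIntegrable ?_)]
  · simp only [Real.log_one]
    ring
  · exact continuousOn_id.mul (ContinuousOn.add (by fun_prop) (continuousOn_const.mul
      (Real.continuousOn_log.mono fun r hr => hp r hr)))
  · have h0 := hp r hr
    refine ((((hasDerivAt_pow 2 r).div_const 2).sub ((hasDerivAt_pow 4 r).div_const 4)).const_mul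
      (f ^ 2 / 4) |>.add (((((hasDerivAt_pow 2 r).div_const 2).mul (Real.hasDerivAt_log h0)).sub
      ((hasDerivAt_pow 2 r).div_const 4)).const_mul (A * f))).congr_deriv ?_
    field_simp
    ring

end RadialIntegrals

section Energy

variable {Ω S : Set Plane} {f u : Plane → ℝ} {g : Plane → Plane}

/-- The energy is defined through the chosen `weakGrad`; an explicit field may replace it because
they agree a.e. on `Ω`, hence on `S`. -/
lemma energyOn_eq_of_hasWeakGradient (hΩ : IsOpen Ω) (hS : MeasurableSet S) (hSΩ : S ⊆ Ω)
    (h : HasWeakGradient Ω u g) {e b : Plane → ℝ} (he : ∀ x ∈ S, ‖g x‖ ^ 2 = e x)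
    (hb : ∀ x ∈ S, f x * u x = b x) :
    energyOn Ω S f u = (1 / 2) * (∫ x in S, e x) - ∫ x in S, b x := by
  rw [energyOn, setIntegral_congr_fun hS hb]
  congr 2
  refine integral_congr_ae ?_
  filter_upwards [ae_restrict_of_ae_restrict_of_subset hSΩ (h.weakGrad_ae_eq hΩ),
    ae_restrict_mem hS] with x hx hxS
  rw [hx, real_inner_self_eq_norm_sq, he x hxS]

lemma energy_eq_add (hS : MeasurableSet S) (hSΩ : S ⊆ Ω) (hf : MemLp f 2 (vol Ω))
    (hu : MemH10 Ω u) : energy Ω f u = energyOn Ω S f u + energyOn Ω (Ω \ S) f u := by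
  have h1 : IntegrableOn (fun x => inner ℝ (weakGrad Ω u x) (weakGrad Ω u x)) Ω :=
    integrable_inner_of_memLp_two hu.memLp_weakGrad hu.memLp_weakGrad
  have h2 : IntegrableOn (fun x => f x * u x) Ω := integrable_mul_of_memLp_two hf hu.memLp
  rw [energy, energyOn, energyOn, energyOn, setIntegral_sdiff hS h1 hSΩ, setIntegral_sdiff hS h2 hSΩ]
  ring

end Energy

end

/-! ### The two regimes: no contact force, and contact on a disk -/

section

variable {f φmax ρ ψ : ℝ}

lemma continuous_sphericalObstacle : Continuous (sphericalObstacle φmax ρ) := by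
  unfold sphericalObstacle
  fun_prop

lemma memLp_const_disk (f : ℝ) : MemLp (fun _ : Plane => f) 2 (vol disk) := memLp_const f

section Free

lemma hasDerivAt_freeProfile (f s : ℝ) : HasDerivAt (fun s => f / 4 * (1 - s)) (-f / 4) s :=
  (((hasDerivAt_id' s).const_sub 1).const_mul (f / 4)).congr_deriv (by ring)

lemma isWeakSolution_freeSolution (f : ℝ) :
    IsWeakSolution disk (fun _ => f) (fun _ => 0) (freeSolution f) :=
  isWeakSolution_radial (h := fun s => f / 4 * (1 - s)) (k := fun _ => -f / 4) (m := fun _ => 0)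
    (L := 0) (hasDerivAt_freeProfile f) continuous_const (by simp)
    (fun _ _ => hasDerivWithinAt_const _ _ _) (by simp)
    (Eventually.of_forall fun x => by ring)

lemma sqrt_le_of_one_le (hρ : 1 ≤ ρ) (s : ℝ) (hs : 0 ≤ s) : √(ρ ^ 2 - s) ≤ ρ :=
  Real.sqrt_le_iff.2 ⟨by linarith, by linarith⟩

/-- From `√(ρ² - r²) ≤ ρ`, solution minus obstacle is at least `(f/4 - φ_max) + |f| r²/4` when `f <
0`. For `|f| ≤ 4|φ_max|` both terms are nonnegative; in the equality case the first vanishes and the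
second is zero only at the origin. -/
lemma sphericalObstacle_le_add (f : ℝ) (hρ : 1 ≤ ρ) (x : Plane) :
    sphericalObstacle φmax ρ x ≤ φmax + (freeSolution f x - f / 4) + f / 4 * ‖x‖ ^ 2 := by
  rw [sphericalObstacle, freeSolution]
  linarith [sqrt_le_of_one_le hρ (‖x‖ ^ 2) (by positivity)]

lemma energy_freeSolution (f : ℝ) :
    energy disk (fun _ => f) (freeSolution f) = -(Real.pi * f ^ 2 / 16) := by
  have hg : HasWeakGradient disk (freeSolution f) fun x => (2 * (-f / 4)) • x :=
    hasWeakGradient_radial (h := fun s => f / 4 * (1 - s)) (k := fun _ => -f / 4)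
      (hasDerivAt_freeProfile f) continuous_const
  rw [energy, energyOn_eq_of_hasWeakGradient isOpen_disk isOpen_disk.measurableSet Subset.rfl hg
    (e := fun x => f ^ 2 / 4 * ‖x‖ ^ 2) (b := fun x => f ^ 2 / 4 * (1 - ‖x‖ ^ 2))
    (fun x _ => ?_) (fun x _ => ?_)]
  · rw [setIntegral_radial_disk fun r => f ^ 2 / 4 * r ^ 2,
      setIntegral_radial_disk fun r => f ^ 2 / 4 * (1 - r ^ 2),
      intervalIntegral.integral_eq_sub_of_hasDerivAt (f := fun r => f ^ 2 / 4 * (r ^ 4 / 4))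
        (fun r _ => (((hasDerivAt_pow 4 r).div_const 4).const_mul (f ^ 2 / 4)).congr_deriv
          (by push_cast; ring)) (Continuous.intervalIntegrable (by fun_prop) _ _),
      intervalIntegral.integral_eq_sub_of_hasDerivAt
        (f := fun r => f ^ 2 / 4 * (r ^ 2 / 2 - r ^ 4 / 4))
        (fun r _ => ((((hasDerivAt_pow 2 r).div_const 2).sub
          ((hasDerivAt_pow 4 r).div_const 4)).const_mul (f ^ 2 / 4)).congr_deriv
          (by push_cast; ring)) (Continuous.intervalIntegrable (by fun_prop) _ _)]
    ring
  · rw [norm_smul, mul_pow, Real.norm_eq_abs, sq_abs]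
    ring
  · rw [freeSolution]
    ring

lemma isTheObstacleSolution_freeSolution (hf : f < 0) (hφ : φmax < 0) (hρ : 1 ≤ ρ)
    (h : |f| ≤ 4 * |φmax|) : IsTheObstacleSolution disk (fun _ => f)
      (sphericalObstacle φmax ρ) (freeSolution f) := by
  rw [abs_of_neg hf, abs_of_neg hφ] at h
  refine (isWeakSolution_freeSolution f).isTheObstacleSolution isOpen_disk isBounded_disk
    (memLp_const_disk f) ⟨memLp_const_disk 0, Eventually.of_forall fun _ => le_rfl⟩
    (Eventually.of_forall fun x => ?_) (Eventually.of_forall fun x => zero_mul _)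
  have := sphericalObstacle_le_add (φmax := φmax) f hρ x
  nlinarith [sq_nonneg ‖x‖]

lemma contactSet_freeSolution (hf : f < 0) (hφ : φmax < 0) (hρ : 1 ≤ ρ)
    (h : |f| = 4 * |φmax|) :
    {x ∈ disk | freeSolution f x = sphericalObstacle φmax ρ x} = {0} := by
  rw [abs_of_neg hf, abs_of_neg hφ] at h
  ext x
  simp only [mem_ofPred_eq, mem_singleton_iff]
  constructor
  · rintro ⟨-, hx⟩
    have := sphericalObstacle_le_add (φmax := φmax) f hρ x
    by_contra hne
    have : 0 < ‖x‖ ^ 2 := by positivity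
    nlinarith
  · rintro rfl
    refine ⟨by simp [mem_disk_iff], ?_⟩
    rw [freeSolution, sphericalObstacle]
    simp only [norm_zero, ne_eq, OfNat.ofNat_ne_zero, not_false_eq_true, zero_pow, sub_zero,
      Real.sqrt_sq (zero_le_one.trans hρ)]
    linarith

end Free

section Contact

/-- The contact circle is negligible, so the jump of the second derivative there does not affect the
weak equation. -/
lemma ae_norm_ne {R : ℝ} (hR : 0 < R) : ∀ᵐ x : Plane ∂(vol disk), ‖x‖ ≠ R := by
  refine ae_restrict_of_ae ?_
  have : volume (Metric.sphere (0 : Plane) R) = 0 := Measure.addHaar_sphere_of_ne_zero _ _ hR.ne'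
  filter_upwards [measure_eq_zero_iff_ae_notMem.1 this] with x hx
  simpa using hx

lemma measurable_contactMultiplier : Measurable (contactMultiplier f ρ ψ) := by
  unfold contactMultiplier
  refine Measurable.ite (measurableSet_lt measurable_const measurable_norm) measurable_const ?_
  refine Measurable.sub (Measurable.div (by fun_prop) (Measurable.pow_const (by fun_prop) _))
    measurable_const

lemma contactMultiplier_nonneg (hf : f < 0) (hρ : 1 ≤ ρ) (hR : 0 < ρ * Real.sin ψ)
    (hR1 : ρ * Real.sin ψ < 1) (x : Plane) : 0 ≤ contactMultiplier f ρ ψ x := by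
  rw [contactMultiplier]
  split_ifs with h
  · exact le_rfl
  · have h1 : ‖x‖ ^ 2 < 1 := by nlinarith [norm_nonneg x]
    have h2 : 1 ≤ ρ ^ 2 := by nlinarith
    have h3 : 0 ≤ (2 * ρ ^ 2 - ‖x‖ ^ 2) / (ρ ^ 2 - ‖x‖ ^ 2) ^ (3 / 2 : ℝ) :=
      div_nonneg (by linarith) (Real.rpow_nonneg (by linarith) _)
    linarith

/-- Off the circle `λ = -f - 4h' - 4‖x‖² h''`, so boundedness of slope and curvature makes `λ`
bounded, hence square-integrable on the disk. -/
lemma contactMultiplier_mem_multipliers (hρ : 1 ≤ ρ)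
    {A : ℝ} (H : IsContactData f φmax ρ (ρ * Real.sin ψ) A) :
    contactMultiplier f ρ ψ ∈ multipliers disk := by
  refine ⟨?_, Eventually.of_forall
    (contactMultiplier_nonneg H.f_neg hρ H.pos H.lt_one)⟩
  obtain ⟨L, hL⟩ := H.exists_bound_curvature
  obtain ⟨M, hM⟩ := (isCompact_Icc (a := (0 : ℝ)) (b := 1)).exists_bound_of_continuousOn
    H.continuous_slope.continuousOn
  refine MemLp.of_bound measurable_contactMultiplier.aestronglyMeasurable (4 * M + 4 * L + |f|) ?_
  filter_upwards [ae_norm_ne H.pos, ae_restrict_mem isOpen_disk.measurableSet] with x hx hxd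
  have e := contactMultiplier_add_eq (f := f) hρ H.pos H.lt_one hx A
  have hs0 : 0 ≤ ‖x‖ ^ 2 := by positivity
  have hs1 := mem_disk_iff_sq.1 hxd
  have b₁ := hM (‖x‖ ^ 2) ⟨hs0, hs1.le⟩
  have b₂ := hL (‖x‖ ^ 2) ⟨hs0, by linarith⟩
  rw [Real.norm_eq_abs, abs_le] at b₁ ⊢
  set K := contactSlope f ρ (ρ * Real.sin ψ) A (‖x‖ ^ 2)
  set m := contactCurvature ρ (ρ * Real.sin ψ) A (‖x‖ ^ 2)
  obtain ⟨b₃, b₄⟩ := abs_le.1 b₂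
  have : 0 ≤ L := (abs_nonneg _).trans b₂
  have c₁ : ‖x‖ ^ 2 * m ≤ L := by nlinarith
  have c₂ : -L ≤ ‖x‖ ^ 2 * m := by nlinarith
  constructor <;> linarith [neg_abs_le f, le_abs_self f]

lemma isWeakSolution_contactSolution (hρ : 1 ≤ ρ)
    (H : IsContactData f φmax ρ (ρ * Real.sin ψ) (logCoeff f φmax ρ ψ)) :
    IsWeakSolution disk (fun _ => f) (contactMultiplier f ρ ψ) (contactSolution f φmax ρ ψ) := by
  obtain ⟨L, hL⟩ := H.exists_bound_curvature
  rw [contactSolution_eq H.pos]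
  refine isWeakSolution_radial H.hasDerivAt_profile H.continuous_slope H.profile_one
    (fun s _ => H.hasDerivWithinAt_slope s) hL ?_
  filter_upwards [ae_norm_ne H.pos] with x hx
  exact contactMultiplier_add_eq hρ H.pos H.lt_one hx _

lemma contactSolution_of_le {x : Plane} (hx : ‖x‖ ≤ ρ * Real.sin ψ) :
    contactSolution f φmax ρ ψ x = sphericalObstacle φmax ρ x := by
  rw [contactSolution, if_neg hx.not_gt]

lemma sphericalObstacle_lt_contactSolution
    (H : IsContactData f φmax ρ (ρ * Real.sin ψ) (logCoeff f φmax ρ ψ)) {x : Plane}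
    (hx : x ∈ disk) (hxR : ρ * Real.sin ψ < ‖x‖) :
    sphericalObstacle φmax ρ x < contactSolution f φmax ρ ψ x := by
  have := H.obstacle_lt ((sq_lt_sq₀ H.pos.le (norm_nonneg x)).2 hxR) (mem_disk_iff_sq.1 hx)
  rw [contactSolution, if_pos hxR, sphericalObstacle]
  rw [Real.log_pow] at this
  push_cast at this
  linarith

lemma sphericalObstacle_le_contactSolution
    (H : IsContactData f φmax ρ (ρ * Real.sin ψ) (logCoeff f φmax ρ ψ)) {x : Plane}
    (hx : x ∈ disk) : sphericalObstacle φmax ρ x ≤ contactSolution f φmax ρ ψ x := by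
  rcases le_or_gt ‖x‖ (ρ * Real.sin ψ) with h | h
  · exact (contactSolution_of_le h).ge
  · exact (sphericalObstacle_lt_contactSolution H hx h).le

lemma contactMultiplier_mul_sub (x : Plane) : contactMultiplier f ρ ψ x *
    (contactSolution f φmax ρ ψ x - sphericalObstacle φmax ρ x) = 0 := by
  rcases le_or_gt ‖x‖ (ρ * Real.sin ψ) with h | h
  · rw [contactSolution_of_le h, sub_self, mul_zero]
  · rw [contactMultiplier, if_pos h, zero_mul]

lemma contactSet_contactSolution
    (H : IsContactData f φmax ρ (ρ * Real.sin ψ) (logCoeff f φmax ρ ψ)) :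
    {x ∈ disk | contactSolution f φmax ρ ψ x = sphericalObstacle φmax ρ x} =
      {x | ‖x‖ ≤ ρ * Real.sin ψ} := by
  ext x
  simp only [mem_ofPred_eq]
  constructor
  · rintro ⟨hx, he⟩
    by_contra hcon
    exact (sphericalObstacle_lt_contactSolution H hx (not_le.1 hcon)).ne' he
  · exact fun hx => ⟨mem_disk_iff.2 (hx.trans_lt H.lt_one), contactSolution_of_le hx⟩

lemma hasGradientAt_contactSolution
    (H : IsContactData f φmax ρ (ρ * Real.sin ψ) (logCoeff f φmax ρ ψ)) (x : Plane) :
    HasGradientAt (contactSolution f φmax ρ ψ) (contactGradient f φmax ρ ψ x) x := by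
  rw [contactSolution_eq H.pos, contactGradient_eq H.pos]
  exact hasGradientAt_radial (H.hasDerivAt_profile _)

lemma hasWeakGradient_contactSolution
    (H : IsContactData f φmax ρ (ρ * Real.sin ψ) (logCoeff f φmax ρ ψ)) :
    HasWeakGradient disk (contactSolution f φmax ρ ψ) (contactGradient f φmax ρ ψ) := by
  rw [contactSolution_eq H.pos, contactGradient_eq H.pos]
  exact hasWeakGradient_radial H.hasDerivAt_profile H.continuous_slope

lemma measurableSet_contact (R : ℝ) : MeasurableSet {x : Plane | ‖x‖ ≤ R} :=
  measurableSet_le measurable_norm measurable_const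

lemma contact_subset_disk {R : ℝ} (hR1 : R < 1) : {x : Plane | ‖x‖ ≤ R} ⊆ disk :=
  fun _ hx => mem_disk_iff.2 (lt_of_le_of_lt hx hR1)

lemma energyOn_contact
    (H : IsContactData f φmax ρ (ρ * Real.sin ψ) (logCoeff f φmax ρ ψ)) :
    energyOn disk {x | ‖x‖ ≤ ρ * Real.sin ψ} (fun _ => f) (contactSolution f φmax ρ ψ) =
      (1 / 2) * (∫ x in {x : Plane | ‖x‖ ≤ ρ * Real.sin ψ}, ‖x‖ ^ 2 / (ρ ^ 2 - ‖x‖ ^ 2)) -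
        ∫ x in {x : Plane | ‖x‖ ≤ ρ * Real.sin ψ}, f * (φmax - ρ + √(ρ ^ 2 - ‖x‖ ^ 2)) := by
  refine energyOn_eq_of_hasWeakGradient isOpen_disk (measurableSet_contact _)
    (contact_subset_disk H.lt_one) (hasWeakGradient_contactSolution H) (fun x hx => ?_)
    fun x hx => by rw [contactSolution_of_le hx, sphericalObstacle]
  have hx' : ‖x‖ ≤ ρ * Real.sin ψ := hx
  have h1 : 0 ≤ ρ ^ 2 - ‖x‖ ^ 2 := by
    nlinarith [norm_nonneg x, H.lt_one, H.one_le_sq]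
  rw [contactGradient, if_neg hx'.not_gt, norm_smul, mul_pow, norm_neg, Real.norm_eq_abs, sq_abs,
    div_pow, Real.sq_sqrt h1]
  ring

lemma energyOn_free
    (H : IsContactData f φmax ρ (ρ * Real.sin ψ) (logCoeff f φmax ρ ψ)) {A : ℝ}
    (hA : A = logCoeff f φmax ρ ψ) :
    energyOn disk (disk \ {x | ‖x‖ ≤ ρ * Real.sin ψ}) (fun _ => f) (contactSolution f φmax ρ ψ) =
      (1 / 2) * (∫ x in disk \ {x : Plane | ‖x‖ ≤ ρ * Real.sin ψ},
          (A ^ 2 / ‖x‖ ^ 2 - A * f + f ^ 2 / 4 * ‖x‖ ^ 2)) -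
        ∫ x in disk \ {x : Plane | ‖x‖ ≤ ρ * Real.sin ψ},
          (f ^ 2 / 4 * (1 - ‖x‖ ^ 2) + A * f * Real.log ‖x‖) := by
  refine energyOn_eq_of_hasWeakGradient isOpen_disk
    (isOpen_disk.measurableSet.diff (measurableSet_contact _))
    sdiff_subset (hasWeakGradient_contactSolution H) (fun x hx => ?_) (fun x hx => ?_)
  · have hx' : ρ * Real.sin ψ < ‖x‖ := not_le.1 hx.2
    have : ‖x‖ ≠ 0 := (H.pos.trans hx').ne'
    rw [contactGradient, if_pos hx', norm_smul, mul_pow, Real.norm_eq_abs, sq_abs, ← hA]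
    field_simp
    ring
  · rw [contactSolution, if_pos (not_le.1 hx.2), ← hA]
    ring

lemma energyOn_contact_closed_form (hρ : 1 ≤ ρ) (hψ : ψ ∈ Ioo 0 (Real.arcsin (1 / ρ)))
    (H : IsContactData f φmax ρ (ρ * Real.sin ψ) (logCoeff f φmax ρ ψ)) :
    energyOn disk {x | ‖x‖ ≤ ρ * Real.sin ψ} (fun _ => f) (contactSolution f φmax ρ ψ) =
      - (Real.pi * ρ ^ 2 / 2) * (Real.sin ψ ^ 2 + Real.log (Real.cos ψ ^ 2))
        - Real.pi * f * ρ ^ 2 * (φmax - ρ) * Real.sin ψ ^ 2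
        - 2 * Real.pi * f * ρ ^ 3 / 3 * (1 - √((1 - Real.sin ψ ^ 2) ^ 3)) := by
  have hc := cos_pos_of_mem hψ
  have h0 : 0 < ρ := by linarith
  have e₁ : ρ ^ 2 - (ρ * Real.sin ψ) ^ 2 = ρ ^ 2 * Real.cos ψ ^ 2 := by
    linear_combination -ρ ^ 2 * Real.sin_sq_add_cos_sq ψ
  have e₂ : √((1 - Real.sin ψ ^ 2) ^ 3) = Real.cos ψ ^ 3 := by
    rw [← Real.cos_sq', show (Real.cos ψ ^ 2) ^ 3 = (Real.cos ψ ^ 3) ^ 2 by ring,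
      Real.sqrt_sq (by positivity)]
  rw [energyOn_contact H, integral_contact_gradient H.pos.le (H.lt_one.trans_le hρ),
    integral_contact_obstacle f H.pos.le (H.lt_one.trans_le hρ), sqrt_sub_radius_sq hρ hψ, e₁, e₂,
    Real.log_mul (by positivity) (by positivity)]
  ring

lemma energyOn_free_closed_form
    (H : IsContactData f φmax ρ (ρ * Real.sin ψ) (logCoeff f φmax ρ ψ)) {R A : ℝ}
    (hR : R = ρ * Real.sin ψ) (hA : A = logCoeff f φmax ρ ψ) :
    energyOn disk (disk \ {x | ‖x‖ ≤ R}) (fun _ => f) (contactSolution f φmax ρ ψ) =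
      - (Real.pi * A ^ 2 * Real.log R) + Real.pi * A * f * R ^ 2 * Real.log R
        - Real.pi * f ^ 2 * (1 - R ^ 2) / 4 + 3 * Real.pi * f ^ 2 * (1 - R ^ 4) / 16 := by
  subst hR
  rw [energyOn_free H hA, integral_free_gradient f A H.pos H.lt_one.le,
    integral_free_load f A H.pos H.lt_one.le]
  ring

end Contact

end

end ObstacleProblem

theorem mainTheorem2 (f φmax ρ : ℝ) (hf : f < 0) (hφ : φmax < 0) (hρ : 1 ≤ ρ) :
    (|f| ≤ 4 * |φmax| →
      ObstacleProblem.IsTheObstacleSolution ObstacleProblem.disk (fun _ => f)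
        (ObstacleProblem.sphericalObstacle φmax ρ) (ObstacleProblem.freeSolution f) ∧
      ObstacleProblem.energy ObstacleProblem.disk (fun _ => f)
        (ObstacleProblem.freeSolution f) = - (Real.pi * f ^ 2 / 16) ∧
      (|f| < 4 * |φmax| → ∀ x ∈ ObstacleProblem.disk,
        ObstacleProblem.sphericalObstacle φmax ρ x < ObstacleProblem.freeSolution f x) ∧
      (|f| = 4 * |φmax| →
        {x ∈ ObstacleProblem.disk |
          ObstacleProblem.freeSolution f x = ObstacleProblem.sphericalObstacle φmax ρ x} = {0})) ∧
    (4 * |φmax| < |f| →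
      (∃! ψ : ℝ, ψ ∈ Set.Ioo 0 (Real.arcsin (1 / ρ)) ∧
        ObstacleProblem.ContactEquation f φmax ρ ψ) ∧
      ∀ ψ ∈ Set.Ioo 0 (Real.arcsin (1 / ρ)), ObstacleProblem.ContactEquation f φmax ρ ψ →
        ∀ (R A : ℝ) (φ u lam : ObstacleProblem.Plane → ℝ) (Ωc Ωf : Set ObstacleProblem.Plane),
          R = ρ * Real.sin ψ →
          A = ObstacleProblem.logCoeff f φmax ρ ψ →
          φ = ObstacleProblem.sphericalObstacle φmax ρ →
          u = ObstacleProblem.contactSolution f φmax ρ ψ →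
          lam = ObstacleProblem.contactMultiplier f ρ ψ →
          Ωc = {x | ‖x‖ ≤ R} →
          Ωf = ObstacleProblem.disk \ Ωc →
          -- the contact radius, the solution and its contact set
          (0 < R ∧ R < 1) ∧
          ObstacleProblem.IsTheObstacleSolution ObstacleProblem.disk (fun _ => f) φ u ∧
          {x ∈ ObstacleProblem.disk | u x = φ x} = Ωc ∧
          -- its gradient, classical and weak
          (∀ x ∈ ObstacleProblem.disk,
            HasGradientAt u (ObstacleProblem.contactGradient f φmax ρ ψ x) x) ∧
          ObstacleProblem.HasWeakGradient ObstacleProblem.disk u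
            (ObstacleProblem.contactGradient f φmax ρ ψ) ∧
          -- its energy
          ObstacleProblem.energy ObstacleProblem.disk (fun _ => f) u =
            ObstacleProblem.energyOn ObstacleProblem.disk Ωc (fun _ => f) u +
              ObstacleProblem.energyOn ObstacleProblem.disk Ωf (fun _ => f) u ∧
          ObstacleProblem.energyOn ObstacleProblem.disk Ωc (fun _ => f) u =
            (1 / 2) * (∫ x in Ωc, ‖x‖ ^ 2 / (ρ ^ 2 - ‖x‖ ^ 2)) -
              ∫ x in Ωc, f * (φmax - ρ + Real.sqrt (ρ ^ 2 - ‖x‖ ^ 2)) ∧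
          ObstacleProblem.energyOn ObstacleProblem.disk Ωf (fun _ => f) u =
            (1 / 2) * (∫ x in Ωf, (A ^ 2 / ‖x‖ ^ 2 - A * f + f ^ 2 / 4 * ‖x‖ ^ 2)) -
              ∫ x in Ωf, (f ^ 2 / 4 * (1 - ‖x‖ ^ 2) + A * f * Real.log ‖x‖) ∧
          ObstacleProblem.energyOn ObstacleProblem.disk Ωc (fun _ => f) u =
            - (Real.pi * ρ ^ 2 / 2) * (Real.sin ψ ^ 2 + Real.log (Real.cos ψ ^ 2))
              - Real.pi * f * ρ ^ 2 * (φmax - ρ) * Real.sin ψ ^ 2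
              - 2 * Real.pi * f * ρ ^ 3 / 3 * (1 - Real.sqrt ((1 - Real.sin ψ ^ 2) ^ 3)) ∧
          ObstacleProblem.energyOn ObstacleProblem.disk Ωf (fun _ => f) u =
            - (Real.pi * A ^ 2 * Real.log R) + Real.pi * A * f * R ^ 2 * Real.log R
              - Real.pi * f ^ 2 * (1 - R ^ 2) / 4 + 3 * Real.pi * f ^ 2 * (1 - R ^ 4) / 16 ∧
          -- its multiplier
          (∀ μ : ObstacleProblem.Plane → ℝ,
            ObstacleProblem.IsOptimalMultiplier ObstacleProblem.disk (fun _ => f) φ u μ ↔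
              μ =ᵐ[ObstacleProblem.vol ObstacleProblem.disk] lam) ∧
          ObstacleProblem.HasWeakLaplacian ObstacleProblem.disk u (fun x => - (lam x + f))) := by
  refine ⟨fun h => ⟨ObstacleProblem.isTheObstacleSolution_freeSolution hf hφ hρ h, ObstacleProblem.energy_freeSolution f,
    fun hlt x _ => ?_, ObstacleProblem.contactSet_freeSolution hf hφ hρ⟩, fun h =>
    ⟨ObstacleProblem.existsUnique_contactAngle hf hφ hρ h, ?_⟩⟩
  -- Strict inequality makes the constant gap `f/4 - φ_max` positive, so contact is excluded even at
  -- the origin.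
  · have h1 := ObstacleProblem.sphericalObstacle_le_add (φmax := φmax) f hρ x
    rw [abs_of_neg hf, abs_of_neg hφ] at hlt
    nlinarith [sq_nonneg ‖x‖]
  · intro ψ hψ hEq R A φ u lam Ωc Ωf hR hA hφ' hu hlam hΩc hΩf
    have H := ObstacleProblem.isContactData_of_contactEquation hf hρ hψ hEq
    have hW := ObstacleProblem.isWeakSolution_contactSolution hρ H
    have hM := ObstacleProblem.contactMultiplier_mem_multipliers hρ H
    have hL := ObstacleProblem.memLp_const_disk f
    subst hR hφ' hu hlam hΩc hΩf
    refine ⟨⟨H.pos, H.lt_one⟩, ?_, ObstacleProblem.contactSet_contactSolution H,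
      fun x _ => ObstacleProblem.hasGradientAt_contactSolution H x, ObstacleProblem.hasWeakGradient_contactSolution H,
      ObstacleProblem.energy_eq_add (ObstacleProblem.measurableSet_contact _) (ObstacleProblem.contact_subset_disk H.lt_one) hL hW.1,
      ObstacleProblem.energyOn_contact H, ObstacleProblem.energyOn_free H hA, ObstacleProblem.energyOn_contact_closed_form hρ hψ H,
      ObstacleProblem.energyOn_free_closed_form H rfl hA, fun μ => ?_, hW.hasWeakLaplacian hL hM.1⟩
    · refine hW.isTheObstacleSolution ObstacleProblem.isOpen_disk ObstacleProblem.isBounded_disk hL hM ?_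
        (Filter.Eventually.of_forall ObstacleProblem.contactMultiplier_mul_sub)
      filter_upwards [MeasureTheory.ae_restrict_mem ObstacleProblem.isOpen_disk.measurableSet] with x hx
      exact ObstacleProblem.sphericalObstacle_le_contactSolution H hx
    · exact hW.isOptimalMultiplier_iff ObstacleProblem.isOpen_disk hL
        (ObstacleProblem.memLp_disk_of_continuous ObstacleProblem.continuous_sphericalObstacle) hM
        (Filter.Eventually.of_forall ObstacleProblem.contactMultiplier_mul_sub) μ
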